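/- Let $\mathbb{T}=\mathbb{R}/2\pi\mathbb{Z}$, identified with the unit circle via $t\mapsto e^{it}$, with Lebesgue measure $|\cdot|$, $|\mathbb{T}|=2\pi$. For real $h\in L^1(\mathbb{T})$ let $$X_h(z)=\frac1{2\pi}\int_0^{2\pi}\frac{e^{i\theta}+z}{e^{i\theta}-z}\,h(\theta)\,d\theta\qquad(|z|<1),$$ so that $\operatorname{Re}X_h$ is the Poisson integral of $h$ and $\tilde u_h=\operatorname{Im}X_h$ is its harmonic conjugate with $\tilde u_h(0)=0$. The conjugate function $\tilde h$ of $h$ is the nontangential boundary function of $\tilde u_h$: for almost every $t$, $\tilde h(t)$ is the limit of $\tilde u_h(z)$ as $z\to e^{it}$ within $\{|z|<1,\ |z-e^{it}|<\alpha(1-|z|)\}$, for every $\alpha>1$. **Theorem.** Let $f\in L^\infty(\mathbb{T})$ be real-valued with $f\ge\pi/2$ almost everywhere, let $E\subset\mathbb{T}$ be Lebesgue measurable with $0<|E|<2\pi$, and set $\rho_E=2\chi_E-1$. Then the conjugate function $\widetilde{f\rho_E}$ exists almost everywhere and is measurable, and there is a constant $C>0$ such that $$\bigl|\{t\in\mathbb{T}:\widetilde{f\rho_E}(t)>\lambda\}\bigr|\ge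 Ce^{-\lambda}\qquad\text{for all }\lambda\ge0.$$ In particular, $\exp(\widetilde{f\rho_E})\notin L^1(\mathbb{T})$. -/

import Mathlib

open MeasureTheory Filter Topology

noncomputable section

instance fact_two_pi_pos : Fact (0 < 2 * Real.pi) := ⟨Real.two_pi_pos⟩

/-- The circle `𝕋 = ℝ / 2πℤ`; its `volume` is Lebesgue measure, of total mass `2π`. -/
abbrev Torus : Type := AddCircle (2 * Real.pi)

/-- The point `e^{it}` of the unit circle in `ℂ`. -/
def boundaryPoint (t : Torus) : ℂ := (AddCircle.toCircle t : ℂ)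

/-- The holomorphic function
`X_h(z) = (1/2π) ∫ (e^{iθ} + z) / (e^{iθ} - z) h(θ) dθ` on the unit disc. -/
def herglotzIntegral (h : Torus → ℝ) (z : ℂ) : ℂ :=
  (2 * Real.pi : ℂ)⁻¹ * ∫ θ : Torus, herglotzRieszKernel 0 z (boundaryPoint θ) * (h θ : ℂ)

/-- The Poisson integral `P[h](z) = (1/2π) ∫ P_z(θ) h(θ) dθ`. -/
def poissonIntegral (h : Torus → ℝ) (z : ℂ) : ℝ :=
  (2 * Real.pi)⁻¹ * ∫ θ : Torus, poissonKernel 0 z (boundaryPoint θ) * h θ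

/-- The harmonic conjugate, vanishing at the origin, of the Poisson integral of `h`:
the imaginary part of `X_h`. See `herglotzIntegral_eq`, `differentiableOn_herglotzIntegral`
and `conjugatePoissonIntegral_zero`. -/
def conjugatePoissonIntegral (h : Torus → ℝ) (z : ℂ) : ℝ := (herglotzIntegral h z).im

/-- The nontangential approach region `Γ_α(ζ) = {z ∈ 𝔻 : |z - ζ| < α (1 - |z|)}` at a point `ζ`
of the unit circle. It is empty for `α ≤ 1`. -/
def approachRegion (α : ℝ) (ζ : ℂ) : Set ℂ :=
  {z | ‖z‖ < 1 ∧ ‖z - ζ‖ < α * (1 - ‖z‖)}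

/-- `φ` has nontangential limit `l` at `ζ`. -/
def HasNontangentialLimit (φ : ℂ → ℝ) (ζ : ℂ) (l : ℝ) : Prop :=
  ∀ α : ℝ, 1 < α → Tendsto φ (𝓝[approachRegion α ζ] ζ) (𝓝 l)

open Classical in
/-- The conjugate function of `h`: the nontangential boundary value of the conjugate Poisson
integral of `h`, set to `0` at the points where there is none. -/
def conjugateFunction (h : Torus → ℝ) (t : Torus) : ℝ :=
  if H : ∃ l : ℝ, HasNontangentialLimit (conjugatePoissonIntegral h) (boundaryPoint t) l
  then H.choose else 0

/-- `ρ_E = 2 χ_E - 1`, equal to `1` on `E` and to `-1` off `E`. -/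
def rho (E : Set Torus) (t : Torus) : ℝ := 2 * E.indicator (fun _ => (1 : ℝ)) t - 1

/-! ### Facts showing that the definitions are the intended ones -/

theorem norm_boundaryPoint (t : Torus) : ‖boundaryPoint t‖ = 1 :=
  Circle.norm_coe _

theorem continuous_boundaryPoint : Continuous boundaryPoint :=
  continuous_subtype_val.comp AddCircle.continuous_toCircle

theorem boundaryPoint_coe (x : ℝ) :
    boundaryPoint (x : Torus) = Complex.exp (x * Complex.I) := by
  simp [boundaryPoint, AddCircle.toCircle_apply_mk, Circle.coe_exp]

theorem boundaryPoint_sub_ne_zero {z : ℂ} (hz : ‖z‖ < 1) (t : Torus) :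
    boundaryPoint t - z ≠ 0 := by
  intro h
  have := norm_boundaryPoint t
  rw [sub_eq_zero.mp h] at this
  linarith

theorem continuous_herglotzRieszKernel_boundaryPoint {z : ℂ} (hz : ‖z‖ < 1) :
    Continuous fun θ : Torus => herglotzRieszKernel 0 z (boundaryPoint θ) := by
  simp only [herglotzRieszKernel_def, sub_zero]
  exact (continuous_boundaryPoint.add continuous_const).div
    (continuous_boundaryPoint.sub continuous_const) (boundaryPoint_sub_ne_zero hz)

theorem integrable_herglotzRieszKernel_mul {h : Torus → ℝ} (hh : Integrable h) {z : ℂ}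
    (hz : ‖z‖ < 1) :
    Integrable fun θ : Torus => herglotzRieszKernel 0 z (boundaryPoint θ) * (h θ : ℂ) := by
  have hc := continuous_herglotzRieszKernel_boundaryPoint hz
  obtain ⟨C, hC⟩ := isCompact_univ.exists_bound_of_continuousOn hc.continuousOn
  exact hh.ofReal.bdd_mul hc.aestronglyMeasurable (ae_of_all _ fun θ => hC θ (Set.mem_univ θ))

/-- `X_h = P[h] + i ũ` on the disc. -/
theorem herglotzIntegral_eq {h : Torus → ℝ} (hh : Integrable h) {z : ℂ} (hz : ‖z‖ < 1) :
    herglotzIntegral h z = poissonIntegral h z + conjugatePoissonIntegral h z * Complex.I := by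
  have hre : (herglotzIntegral h z).re = poissonIntegral h z := by
    have hi := integrable_herglotzRieszKernel_mul hh hz
    have e : ∀ θ, (herglotzRieszKernel 0 z (boundaryPoint θ) * (h θ : ℂ)).re
        = poissonKernel 0 z (boundaryPoint θ) * h θ := by
      intro θ
      rw [poissonKernel_eq_re_herglotzRieszKernel]
      simp
    have h1 : (∫ θ : Torus, herglotzRieszKernel 0 z (boundaryPoint θ) * (h θ : ℂ)).re
        = ∫ θ : Torus, poissonKernel 0 z (boundaryPoint θ) * h θ := by
      simp_rw [← e]
      exact (integral_re hi).symm
    have h2 : ((2 * Real.pi : ℂ)⁻¹) = (((2 * Real.pi)⁻¹ : ℝ) : ℂ) := by push_cast; ring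
    rw [herglotzIntegral, poissonIntegral, h2, Complex.re_ofReal_mul, h1]
  rw [← hre, conjugatePoissonIntegral, Complex.re_add_im]

theorem conjugatePoissonIntegral_zero (h : Torus → ℝ) : conjugatePoissonIntegral h 0 = 0 := by
  have e : ∀ θ, herglotzRieszKernel 0 0 (boundaryPoint θ) = 1 := by
    intro θ
    have : boundaryPoint θ ≠ 0 := by simpa using boundaryPoint_sub_ne_zero (z := 0) (by simp) θ
    simp [herglotzRieszKernel_def, this]
  have h2 : ((2 * Real.pi : ℂ)⁻¹) = (((2 * Real.pi)⁻¹ : ℝ) : ℂ) := by push_cast; ring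
  simp only [conjugatePoissonIntegral, herglotzIntegral, e, one_mul, h2, Complex.im_ofReal_mul]
  rw [integral_complex_ofReal, Complex.ofReal_im, mul_zero]

theorem differentiableOn_herglotzIntegral {h : Torus → ℝ} (hh : Integrable h) :
    DifferentiableOn ℂ (herglotzIntegral h) (Metric.ball 0 1) := by
  intro z₀ hz₀
  rw [mem_ball_zero_iff] at hz₀
  set r : ℝ := (1 - ‖z₀‖) / 2 with hr
  have hr0 : 0 < r := by linarith
  have hball : ∀ z ∈ Metric.ball z₀ r, ‖z‖ < 1 - r := by
    intro z hz
    rw [mem_ball_iff_norm] at hz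
    have := norm_le_norm_add_norm_sub' z z₀
    linarith
  have key := hasDerivAt_integral_of_dominated_loc_of_deriv_le
    (F := fun (z : ℂ) (θ : Torus) => herglotzRieszKernel 0 z (boundaryPoint θ) * (h θ : ℂ))
    (F' := fun (z : ℂ) (θ : Torus) =>
      2 * boundaryPoint θ / (boundaryPoint θ - z) ^ 2 * (h θ : ℂ))
    (bound := fun θ => 2 / r ^ 2 * |h θ|) (μ := (volume : Measure Torus))
    (x₀ := z₀) (Metric.ball_mem_nhds z₀ hr0)
    (by
      filter_upwards [Metric.ball_mem_nhds z₀ hr0] with z hz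
      exact (integrable_herglotzRieszKernel_mul hh
        (by linarith [hball z hz])).aestronglyMeasurable)
    (integrable_herglotzRieszKernel_mul hh hz₀)
    (by
      refine AEStronglyMeasurable.mul (Continuous.aestronglyMeasurable ?_)
        hh.ofReal.aestronglyMeasurable
      exact (continuous_const.mul continuous_boundaryPoint).div
        ((continuous_boundaryPoint.sub continuous_const).pow 2)
        fun t => pow_ne_zero 2 (boundaryPoint_sub_ne_zero hz₀ t))
    (by
      refine ae_of_all _ fun θ z hz => ?_
      have h1 : r ≤ ‖boundaryPoint θ - z‖ := by
        have := norm_sub_norm_le (boundaryPoint θ) z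
        rw [norm_boundaryPoint] at this
        linarith [hball z hz]
      simp only [norm_mul, norm_div, norm_pow, norm_boundaryPoint, Complex.norm_real,
        Real.norm_eq_abs, Complex.norm_ofNat, mul_one]
      gcongr)
    (hh.abs.const_mul _)
    (by
      refine ae_of_all _ fun θ z hz => ?_
      have hne := boundaryPoint_sub_ne_zero (z := z) (by linarith [hball z hz]) θ
      simp only [herglotzRieszKernel_def, sub_zero]
      have hd := (((hasDerivAt_id z).const_add (boundaryPoint θ)).div
        ((hasDerivAt_id z).const_sub (boundaryPoint θ)) hne).mul_const (h θ : ℂ)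
      refine HasDerivAt.congr_deriv (f := fun x : ℂ =>
        (boundaryPoint θ + x) / (boundaryPoint θ - x) * (h θ : ℂ)) hd ?_
      simp only [id]
      congr 2
      ring)
  exact (key.2.const_mul _).differentiableAt.differentiableWithinAt

theorem neBot_nhdsWithin_approachRegion {α : ℝ} (hα : 1 < α) (t : Torus) :
    (𝓝[approachRegion α (boundaryPoint t)] boundaryPoint t).NeBot := by
  have hlim : Tendsto (fun r : ℝ => (r : ℂ) * boundaryPoint t) (𝓝[<] 1)
      (𝓝[approachRegion α (boundaryPoint t)] boundaryPoint t) := by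
    refine tendsto_nhdsWithin_iff.mpr ⟨?_, ?_⟩
    · have hc : Continuous fun r : ℝ => (r : ℂ) * boundaryPoint t := by fun_prop
      simpa using (hc.tendsto 1).mono_left nhdsWithin_le_nhds
    · filter_upwards [Ioo_mem_nhdsLT (zero_lt_one' ℝ)] with r hr
      have h1 : ‖(r : ℂ) * boundaryPoint t‖ = r := by
        rw [norm_mul, norm_boundaryPoint, mul_one, Complex.norm_real, Real.norm_eq_abs,
          abs_of_pos hr.1]
      have h2 : ‖(r : ℂ) * boundaryPoint t - boundaryPoint t‖ = 1 - r := by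
        have : (r : ℂ) * boundaryPoint t - boundaryPoint t
            = ((r - 1 : ℝ) : ℂ) * boundaryPoint t := by push_cast; ring
        rw [this, norm_mul, norm_boundaryPoint, mul_one, Complex.norm_real, Real.norm_eq_abs,
          abs_of_neg (by linarith [hr.2])]
        ring
      refine ⟨by rw [h1]; exact hr.2, ?_⟩
      rw [h1, h2]
      nlinarith [hr.2]
  exact hlim.neBot

/-- The conjugate function is the nontangential limit wherever that limit exists. -/
theorem HasNontangentialLimit.conjugateFunction_eq {h : Torus → ℝ} {t : Torus} {l : ℝ}
    (H : HasNontangentialLimit (conjugatePoissonIntegral h) (boundaryPoint t) l) :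
    conjugateFunction h t = l := by
  have hex : ∃ l : ℝ, HasNontangentialLimit (conjugatePoissonIntegral h) (boundaryPoint t) l :=
    ⟨l, H⟩
  rw [conjugateFunction, dif_pos hex]
  haveI := neBot_nhdsWithin_approachRegion one_lt_two t
  exact tendsto_nhds_unique (hex.choose_spec 2 one_lt_two) (H 2 one_lt_two)

end

open scoped ENNReal ComplexConjugate

/-! ### Integrals over the circle -/

/-! Put `h = f ρ_E`, so that `π/2 ≤ |h| ≤ M` almost everywhere, and let `X = P[h] + i ũ`. On the
boundary `X` avoids the strip `|Re w| < π/2`, but `h` has both signs on sets of positive measure, so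
`P[h]` vanishes at some `z₀` and `X(z₀)` lies on the axis of that strip.

The strip carries the positive harmonic function `e^y cos x`, zero on its edges. Extended by zero it
is subharmonic, but it is unbounded as `y → ∞`. `stripBarrier` caps it at a chosen height by gluing
in a harmonic quadratic. The result `B` is continuous, subharmonic, bounded on `|Re w| ≤ M`, and
zero on `π/2 ≤ |Re w| ≤ M` up to height `l`. Hence `B ∘ X` is bounded and subharmonic on the disc,
and its boundary values vanish where `ũ ≤ l`. Comparison with the Poisson integral gives `e^{-l} ≲
B(X(z₀)) ≲ |{ũ > l}|`, which is the tail bound; non-integrability of the exponential follows.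

Three tools carry this. Fatou's theorem, `ae_hasNontangentialLimit_poissonIntegral`, comes from a
dyadic majorant of the Poisson kernel at Lebesgue points. Since `h ∈ L²`, a Fourier multiplier gives
`ũ = P[g]` with `g ∈ L²` (`exists_conjugatePoissonIntegral_eq_poissonIntegral`), so Fatou's theorem
also yields the conjugate function. Subharmonicity enters only through local holomorphic minorants,
which suffice for the maximum principle and for
`HasHolomorphicMinorants.le_poissonIntegral_of_tendsto`. -/

theorem integral_boundaryPoint_eq_circleAverage {F : Type*} [NormedAddCommGroup F]
    [NormedSpace ℝ F] (φ : ℂ → F) :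
    (2 * Real.pi)⁻¹ • ∫ θ : Torus, φ (boundaryPoint θ) = Real.circleAverage φ 0 1 := by
  rw [Real.circleAverage_def, ← AddCircle.intervalIntegral_preimage (2 * Real.pi) 0, zero_add]
  simp [boundaryPoint_coe, circleMap]

theorem continuous_poissonKernel_boundaryPoint {z : ℂ} (hz : ‖z‖ < 1) :
    Continuous fun θ : Torus => poissonKernel 0 z (boundaryPoint θ) := by
  simp only [poissonKernel_eq_re_herglotzRieszKernel]
  exact Complex.continuous_re.comp (continuous_herglotzRieszKernel_boundaryPoint hz)

theorem integrable_poissonKernel_mul {g : Torus → ℝ} (hg : Integrable g) {z : ℂ}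
    (hz : ‖z‖ < 1) :
    Integrable fun θ : Torus => poissonKernel 0 z (boundaryPoint θ) * g θ := by
  have hc := continuous_poissonKernel_boundaryPoint hz
  obtain ⟨C, hC⟩ := isCompact_univ.exists_bound_of_continuousOn hc.continuousOn
  exact hg.bdd_mul hc.aestronglyMeasurable (ae_of_all _ fun θ => hC θ (Set.mem_univ θ))

theorem poissonKernel_boundaryPoint_eq (z : ℂ) (θ : Torus) :
    poissonKernel 0 z (boundaryPoint θ) = (1 - ‖z‖ ^ 2) / ‖boundaryPoint θ - z‖ ^ 2 := by
  simp [poissonKernel_def, norm_boundaryPoint]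

theorem poissonKernel_boundaryPoint_nonneg {z : ℂ} (hz : ‖z‖ < 1) (θ : Torus) :
    0 ≤ poissonKernel 0 z (boundaryPoint θ) := by
  rw [poissonKernel_boundaryPoint_eq]
  have := norm_nonneg z
  exact div_nonneg (by nlinarith) (by positivity)

theorem poissonIntegral_of_differentiable {p : ℂ → ℂ} (hp : Differentiable ℂ p) {z : ℂ}
    (hz : ‖z‖ < 1) : poissonIntegral (fun θ => (p (boundaryPoint θ)).re) z = (p z).re := by
  have h1 := (hp.diffContOnCl (s := Metric.ball 0 1)).circleAverage_poissonKernel_smul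
    (w := z) (by simpa using hz)
  have h2 := integral_boundaryPoint_eq_circleAverage (poissonKernel 0 z • p)
  rw [h1] at h2
  have hi : Integrable fun θ : Torus => (poissonKernel 0 z • p) (boundaryPoint θ) := by
    have : Continuous fun θ : Torus => (poissonKernel 0 z • p) (boundaryPoint θ) :=
      (continuous_poissonKernel_boundaryPoint hz).smul
        (hp.continuous.comp continuous_boundaryPoint)
    exact this.integrable_of_hasCompactSupport (HasCompactSupport.of_compactSpace _)
  rw [← h2, poissonIntegral, Complex.smul_re, ← RCLike.re_eq_complex_re, ← integral_re hi]
  simp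

theorem poissonIntegral_const (c : ℝ) {z : ℂ} (hz : ‖z‖ < 1) :
    poissonIntegral (fun _ => c) z = c := by
  simpa using poissonIntegral_of_differentiable (p := fun _ => (c : ℂ)) (by fun_prop) hz

/-! ### Nontangential limits of Poisson integrals -/

/-- A chord subtending the angle `x` has length `2 |sin (x/2)|`; Jordan's inequality bounds the sine
below. -/
theorem two_div_pi_mul_dist_le_norm_boundaryPoint_sub (s t : Torus) :
    2 / Real.pi * dist s t ≤ ‖boundaryPoint s - boundaryPoint t‖ := by
  obtain ⟨x, hx, hxs⟩ : ∃ x : ℝ, |x| ≤ Real.pi ∧ (x : Torus) = s - t := by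
    obtain ⟨x, hx, hxs⟩ := (AddCircle.coe_image_Ico_eq (2 * Real.pi) (-Real.pi)).symm ▸
      Set.mem_univ (s - t)
    exact ⟨x, abs_le.2 ⟨hx.1, by linarith [hx.2]⟩, hxs⟩
  have hd : dist s t ≤ |x| := by
    rw [dist_eq_norm, ← hxs]
    refine ((AddCircle.norm_coe_eq_abs_iff (2 * Real.pi) Real.two_pi_pos.ne').2 ?_).le
    rw [abs_of_pos Real.two_pi_pos]
    linarith
  have h1 : boundaryPoint s = boundaryPoint t * boundaryPoint (x : Torus) := by
    rw [hxs]
    simp only [boundaryPoint]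
    rw [← Circle.coe_mul, ← AddCircle.toCircle_add, add_sub_cancel]
  have h2 : ‖boundaryPoint s - boundaryPoint t‖ = ‖Complex.exp (Complex.I * x) - 1‖ := by
    have : boundaryPoint s - boundaryPoint t
        = boundaryPoint t * (boundaryPoint (x : Torus) - 1) := by rw [h1]; ring
    rw [this, norm_mul, norm_boundaryPoint, one_mul, boundaryPoint_coe, mul_comm]
  rw [h2, Complex.norm_exp_I_mul_ofReal_sub_one, norm_mul, Real.norm_ofNat, Real.norm_eq_abs]
  have h3 := Real.mul_abs_le_abs_sin (x := x / 2) (by rw [abs_div, abs_two]; linarith)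
  rw [abs_div, abs_two] at h3
  calc 2 / Real.pi * dist s t ≤ 2 / Real.pi * |x| := by gcongr
    _ = 2 * (2 / Real.pi * (|x| / 2)) := by ring
    _ ≤ _ := by linarith

/-- The distance to a point of an approach region controls the distance on the boundary circle. -/
theorem dist_le_mul_norm_sub_of_mem_approachRegion {α : ℝ} (hα : 1 < α) {t : Torus} {z : ℂ}
    (hz : z ∈ approachRegion α (boundaryPoint t)) (θ : Torus) :
    dist θ t ≤ 2 * (1 + α) * ‖boundaryPoint θ - z‖ := by
  have h1 : 1 - ‖z‖ ≤ ‖boundaryPoint θ - z‖ := by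
    have := norm_sub_norm_le (boundaryPoint θ) z
    rwa [norm_boundaryPoint] at this
  have h2 : ‖boundaryPoint θ - boundaryPoint t‖ ≤
      ‖boundaryPoint θ - z‖ + ‖z - boundaryPoint t‖ := norm_sub_le_norm_sub_add_norm_sub _ _ _
  have h3 := two_div_pi_mul_dist_le_norm_boundaryPoint_sub θ t
  have h4 : 1 / 2 * dist θ t ≤ 2 / Real.pi * dist θ t := by
    gcongr ?_ * _
    rw [div_le_div_iff₀ two_pos Real.pi_pos]
    linarith [Real.pi_le_four]
  have h5 := hz.2
  nlinarith [hz.1]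

theorem poissonKernel_le_of_mem_approachRegion {α : ℝ} (hα : 1 < α) {t : Torus} {z : ℂ}
    (hz : z ∈ approachRegion α (boundaryPoint t)) {θ : Torus} {s : ℝ} (hs : 0 < s)
    (hθ : s ≤ dist θ t) :
    poissonKernel 0 z (boundaryPoint θ) ≤ 8 * (1 + α) ^ 2 * ((1 - ‖z‖) / s ^ 2) := by
  have h1 := dist_le_mul_norm_sub_of_mem_approachRegion hα hz θ
  have hn : 0 < ‖boundaryPoint θ - z‖ := norm_pos_iff.2 (boundaryPoint_sub_ne_zero hz.1 θ)
  have hz1 := hz.1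
  have hz0 := norm_nonneg z
  rw [poissonKernel_boundaryPoint_eq, ← mul_div_assoc, div_le_div_iff₀ (by positivity)
    (by positivity)]
  have h2 : s ^ 2 ≤ (2 * (1 + α) * ‖boundaryPoint θ - z‖) ^ 2 := by gcongr; linarith
  calc (1 - ‖z‖ ^ 2) * s ^ 2 ≤ (2 * (1 - ‖z‖)) * (2 * (1 + α) * ‖boundaryPoint θ - z‖) ^ 2 := by
        apply mul_le_mul _ h2 (by positivity) (by linarith)
        nlinarith
    _ = _ := by ring

theorem poissonKernel_le_two_div {z : ℂ} (hz : ‖z‖ < 1) (θ : Torus) :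
    poissonKernel 0 z (boundaryPoint θ) ≤ 2 / (1 - ‖z‖) := by
  have h := re_herglotzRieszKernel_le (c := 0) (R := 1) (z := boundaryPoint θ) (w := z)
    (by simp [norm_boundaryPoint]) (by simpa using hz)
  rw [poissonKernel_eq_re_herglotzRieszKernel, Function.comp_apply, herglotzRieszKernel_def]
  refine h.trans ?_
  rw [sub_zero]
  gcongr
  linarith

/-- Dyadic majorant of the Poisson kernel at a point of an approach region. -/
theorem exists_dyadic_poissonKernel_le {α : ℝ} (hα : 1 < α) {t : Torus} {z : ℂ}
    (hz : z ∈ approachRegion α (boundaryPoint t)) (θ : Torus) :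
    ∃ j : ℕ, dist θ t ≤ 2 ^ j * (1 - ‖z‖) ∧
      poissonKernel 0 z (boundaryPoint θ) ≤ 32 * (1 + α) ^ 2 / (1 - ‖z‖) * (1 / 4) ^ j := by
  have hδ : 0 < 1 - ‖z‖ := by linarith [hz.1]
  have hex : ∃ j : ℕ, dist θ t ≤ 2 ^ j * (1 - ‖z‖) := by
    obtain ⟨j, hj⟩ := pow_unbounded_of_one_lt (dist θ t / (1 - ‖z‖)) (one_lt_two (α := ℝ))
    exact ⟨j, by rw [div_lt_iff₀ hδ] at hj; exact hj.le⟩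
  classical
  -- With `j` minimal, either `j = 0` and the global bound `2 / (1 - ‖z‖)` suffices, or the distance
  -- exceeds `2 ^ (j - 1) * (1 - ‖z‖)` and the decay estimate applies. The shift by one turns the
  -- constant 8 into 32.
  refine ⟨Nat.find hex, Nat.find_spec hex, ?_⟩
  rcases hj : Nat.find hex with _ | i
  · refine (poissonKernel_le_two_div hz.1 θ).trans ?_
    rw [pow_zero, mul_one]
    gcongr
    nlinarith
  · have hi : ¬ dist θ t ≤ 2 ^ i * (1 - ‖z‖) := Nat.find_min hex (by omega)
    refine (poissonKernel_le_of_mem_approachRegion hα hz (s := 2 ^ i * (1 - ‖z‖))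
      (by positivity) (not_le.1 hi).le).trans (le_of_eq ?_)
    have : ((1 : ℝ) / 4) ^ i = 1 / (2 ^ i) ^ 2 := by
      rw [← pow_mul, mul_comm, pow_mul, one_div_pow]; norm_num
    rw [pow_succ _ i, this]
    field_simp
    ring

/-- The majorant is of size `4^{-j} / δ` on the ball of radius `2^j δ`, where `φ` has integral at
most `ε 2^j δ`. The geometric series in `2^{-j}` sums to 2, whence 64 from 32. -/
theorem lintegral_poissonKernel_mul_le {α : ℝ} (hα : 1 < α) {t : Torus} {z : ℂ}
    (hz : z ∈ approachRegion α (boundaryPoint t)) {φ : Torus → ℝ≥0∞} (hφ : AEMeasurable φ)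
    {ε : ℝ≥0∞} (hε : ∀ s : ℝ, 0 < s →
      ∫⁻ θ in Metric.closedBall t s, φ θ ≤ ε * ENNReal.ofReal s) :
    ∫⁻ θ, ENNReal.ofReal (poissonKernel 0 z (boundaryPoint θ)) * φ θ ≤
      ENNReal.ofReal (64 * (1 + α) ^ 2) * ε := by
  have hδ : 0 < 1 - ‖z‖ := by linarith [hz.1]
  set δ := 1 - ‖z‖ with hδ'
  set B : ℕ → Set Torus := fun j => Metric.closedBall t (2 ^ j * δ) with hB
  set c : ℕ → ℝ≥0∞ := fun j => ENNReal.ofReal (32 * (1 + α) ^ 2 / δ * (1 / 4) ^ j) with hc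
  have h1 : ∀ θ, ENNReal.ofReal (poissonKernel 0 z (boundaryPoint θ)) * φ θ ≤
      ∑' j, c j * (B j).indicator φ θ := by
    intro θ
    obtain ⟨j, hj, hj'⟩ := exists_dyadic_poissonKernel_le hα hz θ
    refine le_trans ?_ (ENNReal.le_tsum j)
    rw [Set.indicator_of_mem (show θ ∈ B j from hj)]
    gcongr
    exact ENNReal.ofReal_le_ofReal hj'
  have hm : ∀ j, MeasurableSet (B j) := fun j => Metric.isClosed_closedBall.measurableSet
  calc _ ≤ ∫⁻ θ, ∑' j, c j * (B j).indicator φ θ := lintegral_mono h1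
    _ = ∑' j, c j * ∫⁻ θ in B j, φ θ := by
        rw [lintegral_tsum fun j => (hφ.indicator (hm j)).const_mul _]
        congr 1; ext j
        rw [lintegral_const_mul'' _ (hφ.indicator (hm j)), lintegral_indicator (hm j)]
    _ ≤ ∑' j, c j * (ε * ENNReal.ofReal (2 ^ j * δ)) := by
        gcongr with j
        exact hε _ (by positivity)
    _ = ∑' j, ε * ENNReal.ofReal (32 * (1 + α) ^ 2 * (1 / 2) ^ j) := by
        congr 1; ext j
        rw [mul_left_comm, hc, ← ENNReal.ofReal_mul (by positivity)]
        congr 2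
        have : ((1 : ℝ) / 4) ^ j = (1 / 2) ^ j * (1 / 2) ^ j := by
          rw [← mul_pow]; norm_num
        rw [this]
        field_simp
        rw [← mul_pow]
        norm_num
    _ = _ := by
        rw [ENNReal.tsum_mul_left, ← ENNReal.ofReal_tsum_of_nonneg (fun j => by positivity)
          (summable_geometric_two.mul_left _), tsum_mul_left, tsum_geometric_two, mul_comm]
        congr 2
        ring

theorem ae_forall_lintegral_closedBall_le {g : Torus → ℝ} (hg : Integrable g) :
    ∀ᵐ t : Torus, ∀ ε : ℝ, 0 < ε → ∃ s₀ : ℝ, 0 < s₀ ∧ ∀ s : ℝ, 0 < s → s ≤ s₀ →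
      ∫⁻ θ in Metric.closedBall t s, ‖g θ - g t‖ₑ ≤ ENNReal.ofReal ε * ENNReal.ofReal s := by
  filter_upwards [IsUnifLocDoublingMeasure.ae_tendsto_average_norm_sub volume
    hg.locallyIntegrable 1] with t ht ε hε
  have h1 := ht (l := 𝓝[>] (0 : ℝ)) (fun _ => t) id tendsto_id (by
    filter_upwards [self_mem_nhdsWithin] with s hs
    simpa using le_of_lt hs)
  -- The half compensates for the ball's measure, which is at most `2 s`.
  have h2 : ∀ᶠ s in 𝓝[>] (0 : ℝ), ⨍ θ in Metric.closedBall t s, ‖g θ - g t‖ < ε / 2 :=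
    h1.eventually (gt_mem_nhds (by positivity))
  obtain ⟨s₀, hs₀, hs₀'⟩ := mem_nhdsGT_iff_exists_Ioc_subset.1 h2
  refine ⟨s₀, hs₀, fun s hs hss => ?_⟩
  have h3 : ⨍ θ in Metric.closedBall t s, ‖g θ - g t‖ < ε / 2 := hs₀' ⟨hs, hss⟩
  have hi : Integrable (fun θ => g θ - g t) (volume.restrict (Metric.closedBall t s)) :=
    (hg.sub (integrable_const _)).restrict
  have hvol : volume.real (Metric.closedBall t s) ≤ 2 * s := by
    rw [measureReal_def, AddCircle.volume_closedBall]
    refine ENNReal.toReal_le_of_le_ofReal (by positivity) (ENNReal.ofReal_le_ofReal ?_)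
    exact min_le_right _ _
  have hvol0 : 0 < volume.real (Metric.closedBall t s) :=
    ENNReal.toReal_pos (Metric.measure_closedBall_pos _ _ hs).ne' (measure_ne_top _ _)
  have h4 : ∫ θ in Metric.closedBall t s, ‖g θ - g t‖ ≤ ε * s := by
    rw [setAverage_eq, smul_eq_mul, inv_mul_lt_iff₀ hvol0] at h3
    nlinarith
  rw [← ENNReal.ofReal_mul hε.le]
  have h5 := ofReal_integral_norm_eq_lintegral_enorm hi
  rw [← h5]
  exact ENNReal.ofReal_le_ofReal h4

theorem abs_poissonIntegral_sub_le {g : Torus → ℝ} (hg : Integrable g) {z : ℂ} (hz : ‖z‖ < 1)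
    (c : ℝ) : ENNReal.ofReal |poissonIntegral g z - c| ≤
      ∫⁻ θ, ENNReal.ofReal (poissonKernel 0 z (boundaryPoint θ)) * ‖g θ - c‖ₑ := by
  have h1 : poissonIntegral g z - c = (2 * Real.pi)⁻¹ *
      ∫ θ : Torus, poissonKernel 0 z (boundaryPoint θ) * (g θ - c) := by
    conv_lhs => rw [← poissonIntegral_const c hz]
    simp only [poissonIntegral]
    rw [← mul_sub, ← integral_sub (integrable_poissonKernel_mul hg hz)
      (integrable_poissonKernel_mul (integrable_const c) hz)]
    simp only [mul_sub]
  have h2 : |poissonIntegral g z - c| ≤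
      ‖∫ θ : Torus, poissonKernel 0 z (boundaryPoint θ) * (g θ - c)‖ := by
    rw [h1, abs_mul, abs_of_pos (by positivity), Real.norm_eq_abs]
    refine mul_le_of_le_one_left (abs_nonneg _) (inv_le_one_of_one_le₀ ?_)
    linarith [Real.pi_gt_three]
  calc _ ≤ ENNReal.ofReal ‖∫ θ : Torus, poissonKernel 0 z (boundaryPoint θ) * (g θ - c)‖ :=
        ENNReal.ofReal_le_ofReal h2
    _ ≤ ∫⁻ θ, ‖poissonKernel 0 z (boundaryPoint θ) * (g θ - c)‖ₑ := by
        rw [ofReal_norm]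
        exact enorm_integral_le_lintegral_enorm _
    _ = _ := by
        congr 1; ext θ
        rw [enorm_mul, Real.enorm_of_nonneg (poissonKernel_boundaryPoint_nonneg hz θ)]

/-- **Fatou's theorem**: the Poisson integral of an integrable function has nontangential limits
almost everywhere, equal to that function. -/
theorem ae_hasNontangentialLimit_poissonIntegral {g : Torus → ℝ} (hg : Integrable g) :
    ∀ᵐ t : Torus, HasNontangentialLimit (poissonIntegral g) (boundaryPoint t) (g t) := by
  filter_upwards [ae_forall_lintegral_closedBall_le hg] with t ht α hα
  have hi : Integrable (fun θ => g θ - g t) := hg.sub (integrable_const _)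
  set I : ℝ := ∫ θ, ‖g θ - g t‖ with hI
  have hI0 : 0 ≤ I := integral_nonneg fun _ => norm_nonneg _
  set K : ℝ := 64 * (1 + α) ^ 2 with hK
  have hKpos : 0 < K := by positivity
  rw [Metric.tendsto_nhds]
  intro ε hε
  obtain ⟨s₀, hs₀, hs⟩ := ht (ε / (2 * K)) (by positivity)
  have hδ : Tendsto (fun z : ℂ => K * ((1 - ‖z‖) / s₀ ^ 2) * I)
      (𝓝[approachRegion α (boundaryPoint t)] boundaryPoint t) (𝓝 0) := by
    have : Continuous fun z : ℂ => K * ((1 - ‖z‖) / s₀ ^ 2) * I := by fun_prop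
    simpa [norm_boundaryPoint] using (this.tendsto (boundaryPoint t)).mono_left nhdsWithin_le_nhds
  filter_upwards [self_mem_nhdsWithin, hδ.eventually (gt_mem_nhds (half_pos hε))] with z hz hz2
  have hz1 : 0 < 1 - ‖z‖ := by linarith [hz.1]
  set B := Metric.closedBall t s₀ with hB
  have hBm : MeasurableSet B := Metric.isClosed_closedBall.measurableSet
  have hφ : AEMeasurable (fun θ => ‖g θ - g t‖ₑ) := hi.aestronglyMeasurable.enorm
  have hnear : ∫⁻ θ in B, ENNReal.ofReal (poissonKernel 0 z (boundaryPoint θ)) * ‖g θ - g t‖ₑ ≤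
      ENNReal.ofReal (ε / 2) := by
    -- Smallness is known only for radii up to `s₀`. Cutting the function off outside `B` makes the
    -- bound hold for every radius.
    have h1 := lintegral_poissonKernel_mul_le hα hz (hφ.indicator hBm)
      (ε := ENNReal.ofReal (ε / (2 * K))) (fun s hs' => by
        rw [← lintegral_indicator Metric.isClosed_closedBall.measurableSet, Set.indicator_indicator,
          lintegral_indicator (Metric.isClosed_closedBall.measurableSet.inter hBm)]
        rcases le_total s s₀ with h | h
        · exact (lintegral_mono_set Set.inter_subset_left).trans (hs s hs' h)
        · refine (lintegral_mono_set Set.inter_subset_right).trans ((hs s₀ hs₀ le_rfl).trans ?_)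
          gcongr)
    rw [← ENNReal.ofReal_mul (by positivity), ← hK] at h1
    rw [← lintegral_indicator hBm]
    have hε2 : K * (ε / (2 * K)) = ε / 2 := by field_simp
    rw [hε2] at h1
    refine (lintegral_mono fun θ => ?_).trans h1
    by_cases h : θ ∈ B
    · rw [Set.indicator_of_mem h, Set.indicator_of_mem h]
    · rw [Set.indicator_of_notMem h]
      exact zero_le
  have hfar : ∫⁻ θ in Bᶜ, ENNReal.ofReal (poissonKernel 0 z (boundaryPoint θ)) * ‖g θ - g t‖ₑ ≤
      ENNReal.ofReal (K * ((1 - ‖z‖) / s₀ ^ 2) * I) := by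
    calc _ ≤ ∫⁻ θ in Bᶜ, ENNReal.ofReal (K * ((1 - ‖z‖) / s₀ ^ 2)) * ‖g θ - g t‖ₑ := by
          refine setLIntegral_mono' hBm.compl fun θ hθ => ?_
          gcongr
          have hd : s₀ ≤ dist θ t := by
            simp only [hB, Set.mem_compl_iff, Metric.mem_closedBall, not_le] at hθ
            exact hθ.le
          refine (poissonKernel_le_of_mem_approachRegion hα hz hs₀ hd).trans ?_
          gcongr
          rw [hK]
          nlinarith
      _ ≤ ∫⁻ θ, ENNReal.ofReal (K * ((1 - ‖z‖) / s₀ ^ 2)) * ‖g θ - g t‖ₑ :=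
          setLIntegral_le_lintegral _ _
      _ = _ := by
          rw [lintegral_const_mul'' _ hφ, ← ofReal_integral_norm_eq_lintegral_enorm hi,
            ← ENNReal.ofReal_mul (by positivity)]
  have htot := abs_poissonIntegral_sub_le hg hz.1 (g t)
  rw [← lintegral_add_compl _ hBm] at htot
  have h2 := htot.trans (add_le_add hnear hfar)
  rw [← ENNReal.ofReal_add (by positivity) (by positivity),
    ENNReal.ofReal_le_ofReal_iff (by positivity)] at h2
  rw [Real.dist_eq]
  linarith

/-! ### The conjugate Poisson integral as a Poisson integral -/

theorem fourier_natCast_eq_boundaryPoint_pow (n : ℕ) (θ : Torus) :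
    fourier (n : ℤ) θ = boundaryPoint θ ^ n := by
  simp [boundaryPoint, fourier_apply, AddCircle.toCircle_nsmul]

theorem integral_haarAddCircle_boundaryPoint (φ : ℂ → ℂ) :
    ∫ θ : Torus, φ (boundaryPoint θ) ∂AddCircle.haarAddCircle = Real.circleAverage φ 0 1 := by
  rw [← integral_boundaryPoint_eq_circleAverage, AddCircle.integral_haarAddCircle]

/-- On the unit circle the conjugate of the kernel equals `(1 + z̄ w) / (1 - z̄ w)`, holomorphic
near the closed disc, so the mean value property evaluates the integral at `w = 0`. -/
theorem integral_conj_herglotzRieszKernel_mul_pow {z : ℂ} (hz : ‖z‖ < 1) (n : ℕ) :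
    ∫ θ : Torus, conj (herglotzRieszKernel 0 z (boundaryPoint θ)) * boundaryPoint θ ^ n
      ∂AddCircle.haarAddCircle = 0 ^ n := by
  have hne : ∀ w : ℂ, ‖w‖ ≤ 1 → 1 - conj z * w ≠ 0 := by
    intro w hw h
    have h1 : ‖conj z * w‖ = 1 := by rw [← sub_eq_zero.1 h]; simp
    rw [norm_mul, RCLike.norm_conj] at h1
    nlinarith [norm_nonneg z, norm_nonneg w]
  have h1 : ∀ θ : Torus, conj (herglotzRieszKernel 0 z (boundaryPoint θ)) * boundaryPoint θ ^ n
      = (fun w : ℂ => (1 + conj z * w) / (1 - conj z * w) * w ^ n) (boundaryPoint θ) := by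
    intro θ
    have hb : boundaryPoint θ * conj (boundaryPoint θ) = 1 := by
      rw [Complex.mul_conj, Complex.normSq_eq_norm_sq, norm_boundaryPoint]; simp
    have hb0 : boundaryPoint θ ≠ 0 := left_ne_zero_of_mul_eq_one hb
    have hd : conj (boundaryPoint θ - z) ≠ 0 := by
      rw [map_ne_zero]
      exact boundaryPoint_sub_ne_zero hz θ
    simp only [herglotzRieszKernel_def, sub_zero, map_div₀]
    congr 1
    rw [div_eq_div_iff hd (hne _ (norm_boundaryPoint θ).le)]
    simp only [map_add, map_sub]
    linear_combination (-2 * conj z) * hb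
  refine (integral_congr_ae (ae_of_all _ h1)).trans
    ((integral_haarAddCircle_boundaryPoint
      fun w : ℂ => (1 + conj z * w) / (1 - conj z * w) * w ^ n).trans ?_)
  rw [DiffContOnCl.circleAverage]
  · simp
  · rw [abs_one]
    apply DifferentiableOn.diffContOnCl
    rw [closure_ball 0 one_ne_zero]
    intro w hw
    have hw' := hne w (by simpa using hw)
    have : DifferentiableAt ℂ (fun w : ℂ => (1 + conj z * w) / (1 - conj z * w) * w ^ n) w := by
      fun_prop (disch := assumption)
    exact this.differentiableWithinAt

/-- The symbol of the conjugation operator. -/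
noncomputable def conjugationSymbol (n : ℤ) : ℂ := -Complex.I * (n.sign : ℂ)

/-- Splitting the preceding integral into real and imaginary parts settles `n > 0`. Conjugation
gives `n < 0`, because both parts are real. For `n = 0` the imaginary part of the kernel has mean
zero. -/
theorem integral_im_herglotzRieszKernel_mul_fourier {z : ℂ} (hz : ‖z‖ < 1) (n : ℤ) :
    ∫ θ : Torus, ((herglotzRieszKernel 0 z (boundaryPoint θ)).im : ℂ) * fourier n θ
      ∂AddCircle.haarAddCircle = conjugationSymbol n *
    ∫ θ : Torus, ((herglotzRieszKernel 0 z (boundaryPoint θ)).re : ℂ) * fourier n θ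
      ∂AddCircle.haarAddCircle := by
  set k : Torus → ℂ := fun θ => herglotzRieszKernel 0 z (boundaryPoint θ) with hk
  have hkc : Continuous k := continuous_herglotzRieszKernel_boundaryPoint hz
  have hint : ∀ φ : Torus → ℂ, Continuous φ → Integrable φ AddCircle.haarAddCircle := fun φ hφ =>
    hφ.integrable_of_hasCompactSupport (HasCompactSupport.of_compactSpace _)
  have hP : ∀ n : ℤ, Integrable (fun θ : Torus => ((k θ).re : ℂ) * fourier n θ)
      AddCircle.haarAddCircle := fun n => hint _ (by fun_prop)
  have hQ : ∀ n : ℤ, Integrable (fun θ : Torus => ((k θ).im : ℂ) * fourier n θ)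
      AddCircle.haarAddCircle := fun n => hint _ (by fun_prop)
  have key : ∀ m : ℕ,
      (∫ θ : Torus, ((k θ).re : ℂ) * fourier (m : ℤ) θ ∂AddCircle.haarAddCircle) - Complex.I *
      (∫ θ : Torus, ((k θ).im : ℂ) * fourier (m : ℤ) θ ∂AddCircle.haarAddCircle) = 0 ^ m := by
    intro m
    rw [← integral_conj_herglotzRieszKernel_mul_pow hz m, ← integral_const_mul,
      ← integral_sub (hP m) ((hQ m).const_mul _)]
    congr 1; ext θ
    rw [fourier_natCast_eq_boundaryPoint_pow]
    have : conj (k θ) = (k θ).re - Complex.I * (k θ).im := by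
      apply Complex.ext <;> simp
    rw [this]
    ring
  have hconj : ∀ (φ : Torus → ℝ) (n : ℤ),
      ∫ θ : Torus, (φ θ : ℂ) * fourier (-n) θ ∂AddCircle.haarAddCircle =
      conj (∫ θ : Torus, (φ θ : ℂ) * fourier n θ ∂AddCircle.haarAddCircle) := by
    intro φ n
    rw [← integral_conj]
    simp only [fourier_neg, map_mul, Complex.conj_ofReal]
  have hpos : ∀ m : ℕ, 0 < m →
      ∫ θ : Torus, ((k θ).im : ℂ) * fourier (m : ℤ) θ ∂AddCircle.haarAddCircle =
      -Complex.I * ∫ θ : Torus, ((k θ).re : ℂ) * fourier (m : ℤ) θ ∂AddCircle.haarAddCircle := by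
    intro m hm
    have h := key m
    rw [zero_pow hm.ne'] at h
    linear_combination Complex.I * h +
      (∫ θ : Torus, ((k θ).im : ℂ) * fourier (m : ℤ) θ ∂AddCircle.haarAddCircle) * Complex.I_sq
  change ∫ θ : Torus, ((k θ).im : ℂ) * fourier n θ ∂AddCircle.haarAddCircle =
    conjugationSymbol n * ∫ θ : Torus, ((k θ).re : ℂ) * fourier n θ ∂AddCircle.haarAddCircle
  rcases lt_trichotomy n 0 with hn | rfl | hn
  · obtain ⟨m, rfl⟩ : ∃ m : ℕ, n = -(m : ℤ) := ⟨n.natAbs, by omega⟩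
    rw [hconj (fun θ => (k θ).re), hconj (fun θ => (k θ).im), hpos m (by omega),
      conjugationSymbol, Int.sign_eq_neg_one_of_neg hn]
    simp
  · have h := key 0
    simp only [Nat.cast_zero, fourier_zero, mul_one, pow_zero] at h ⊢
    rw [integral_complex_ofReal, integral_complex_ofReal] at h ⊢
    have h2 := congrArg Complex.im h
    simp at h2
    simp [conjugationSymbol, h2]
  · obtain ⟨m, rfl⟩ : ∃ m : ℕ, n = (m : ℤ) := ⟨n.natAbs, by omega⟩
    rw [hpos m (by omega), conjugationSymbol, Int.sign_eq_one_of_pos hn]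
    simp

/-- The conjugation operator on `L²`, as a Fourier multiplier. -/
theorem exists_fourierBasis_repr_eq_conjugationSymbol_mul
    (H : Lp ℂ 2 (AddCircle.haarAddCircle (T := 2 * Real.pi))) :
    ∃ G : Lp ℂ 2 (AddCircle.haarAddCircle (T := 2 * Real.pi)),
      ∀ n : ℤ, fourierBasis.repr G n = conjugationSymbol n * fourierBasis.repr H n := by
  have hb : ∀ n, ‖conjugationSymbol n‖ ≤ 1 := by
    intro n
    rcases lt_trichotomy n 0 with hn | rfl | hn
    · simp [conjugationSymbol, Int.sign_eq_neg_one_of_neg hn]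
    · simp [conjugationSymbol]
    · simp [conjugationSymbol, Int.sign_eq_one_of_pos hn]
  have hm : Memℓp (fun n : ℤ => conjugationSymbol n * fourierBasis.repr H n) 2 := by
    refine (lp.memℓp (fourierBasis.repr H)).mono' fun n => ?_
    rw [norm_mul]
    exact mul_le_of_le_one_left (norm_nonneg _) (hb n)
  exact ⟨fourierBasis.repr.symm ⟨_, hm⟩, fun n => by simp⟩

theorem inner_toLp_ofReal {φ : Torus → ℝ}
    (hφ : MemLp (fun θ => (φ θ : ℂ)) 2 (AddCircle.haarAddCircle (T := 2 * Real.pi)))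
    (G : Lp ℂ 2 (AddCircle.haarAddCircle (T := 2 * Real.pi))) :
    inner ℂ (hφ.toLp _) G = ∫ θ : Torus, (φ θ : ℂ) * G θ ∂AddCircle.haarAddCircle := by
  rw [L2.inner_def]
  refine integral_congr_ae ?_
  filter_upwards [hφ.coeFn_toLp] with θ hθ
  rw [hθ]
  simp [mul_comm]

/-- The harmonic conjugate of the Poisson integral of a square integrable function is itself the
Poisson integral of a square integrable function. -/
theorem exists_conjugatePoissonIntegral_eq_poissonIntegral {h : Torus → ℝ} (hh : MemLp h 2) :
    ∃ g : Torus → ℝ, MemLp g 2 ∧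
      ∀ z : ℂ, ‖z‖ < 1 → conjugatePoissonIntegral h z = poissonIntegral g z := by
  have hhc : MemLp (fun θ => (h θ : ℂ)) 2 (AddCircle.haarAddCircle (T := 2 * Real.pi)) :=
    memLp_haarAddCircle_iff.2 hh.ofReal
  obtain ⟨G, hG⟩ := exists_fourierBasis_repr_eq_conjugationSymbol_mul (hhc.toLp _)
  have hGm : MemLp G 2 (volume : Measure Torus) := memLp_haarAddCircle_iff.1 (Lp.memLp G)
  -- No proof that `G` is real is needed: the Poisson kernel and the conjugate Poisson integral are
  -- real, so real parts can be taken at the end.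
  refine ⟨fun θ => (G θ).re, hGm.re, fun z hz => ?_⟩
  have hkc := continuous_herglotzRieszKernel_boundaryPoint hz
  have hmem : ∀ φ : Torus → ℝ, Continuous φ →
      MemLp (fun θ => (φ θ : ℂ)) 2 (AddCircle.haarAddCircle (T := 2 * Real.pi)) := by
    intro φ hφ
    have hc : Continuous fun θ => (φ θ : ℂ) := by fun_prop
    exact hc.memLp_of_hasCompactSupport (HasCompactSupport.of_compactSpace _)
  have hP := hmem (fun θ => (herglotzRieszKernel 0 z (boundaryPoint θ)).re) (by fun_prop)
  have hQ := hmem (fun θ => (herglotzRieszKernel 0 z (boundaryPoint θ)).im) (by fun_prop)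
  -- Parseval: the symbol relating the Fourier coefficients of the two kernels is transferred to
  -- those of `h`, where it produces `G`.
  have hin : inner ℂ (hQ.toLp _) (hhc.toLp _) = inner ℂ (hP.toLp _) G := by
    rw [← fourierBasis.tsum_inner_mul_inner (hQ.toLp _), ← fourierBasis.tsum_inner_mul_inner
      (hP.toLp _)]
    congr 1; ext n
    rw [← HilbertBasis.repr_apply_apply, ← HilbertBasis.repr_apply_apply, hG n,
      inner_toLp_ofReal, inner_toLp_ofReal, coe_fourierBasis]
    have hcongr : ∀ φ : Torus → ℝ, ∫ θ : Torus, (φ θ : ℂ) * (fourierLp 2 n : Lp ℂ 2 _) θ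
        ∂AddCircle.haarAddCircle
        = ∫ θ : Torus, (φ θ : ℂ) * fourier n θ ∂AddCircle.haarAddCircle := by
      intro φ
      refine integral_congr_ae ?_
      filter_upwards [coeFn_fourierLp 2 n] with θ hθ
      rw [hθ]
    rw [hcongr, hcongr, integral_im_herglotzRieszKernel_mul_fourier hz n]
    ring
  have hcongr : ∫ θ : Torus, ((herglotzRieszKernel 0 z (boundaryPoint θ)).im : ℂ) *
      hhc.toLp _ θ ∂AddCircle.haarAddCircle =
      ∫ θ : Torus, ((herglotzRieszKernel 0 z (boundaryPoint θ)).im : ℂ) * (h θ : ℂ)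
        ∂AddCircle.haarAddCircle := by
    refine integral_congr_ae ?_
    filter_upwards [hhc.coeFn_toLp] with θ hθ
    rw [hθ]
  rw [inner_toLp_ofReal, inner_toLp_ofReal, hcongr, AddCircle.integral_haarAddCircle,
    AddCircle.integral_haarAddCircle] at hin
  have hre := congrArg Complex.re hin
  have hGi : Integrable G (volume : Measure Torus) := hGm.integrable (by norm_num)
  have hPG : Integrable fun θ : Torus =>
      ((herglotzRieszKernel 0 z (boundaryPoint θ)).re : ℂ) * G θ := by
    have hc : Continuous fun θ : Torus =>
      ((herglotzRieszKernel 0 z (boundaryPoint θ)).re : ℂ) := by fun_prop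
    obtain ⟨C, hC⟩ := isCompact_univ.exists_bound_of_continuousOn hc.continuousOn
    exact hGi.bdd_mul hc.aestronglyMeasurable (ae_of_all _ fun θ => hC θ (Set.mem_univ θ))
  have hkh := integrable_herglotzRieszKernel_mul (hh.integrable (by norm_num)) hz
  have hleft : conjugatePoissonIntegral h z = ((2 * Real.pi)⁻¹ • ∫ θ : Torus,
      ((herglotzRieszKernel 0 z (boundaryPoint θ)).im : ℂ) * (h θ : ℂ)).re := by
    have h2 : ((2 * Real.pi : ℂ)⁻¹) = (((2 * Real.pi)⁻¹ : ℝ) : ℂ) := by push_cast; ring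
    have h3 := integral_im hkh
    simp only [RCLike.im_eq_complex_im] at h3
    rw [conjugatePoissonIntegral, herglotzIntegral, h2, Complex.im_ofReal_mul, ← h3,
      Complex.smul_re, smul_eq_mul]
    simp_rw [← Complex.ofReal_mul]
    rw [integral_complex_ofReal, Complex.ofReal_re]
    simp
  have h3 := integral_re hPG
  simp only [RCLike.re_eq_complex_re] at h3
  rw [hleft, hre, Complex.smul_re, ← h3, poissonIntegral, poissonKernel_eq_re_herglotzRieszKernel]
  simp

/-! ### Functions with holomorphic minorants -/

/-- `G` is supported from below, at every point of `s`, by the real part of a function holomorphic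
near that point. A continuous function with this property is subharmonic. -/
def HasHolomorphicMinorants (G : ℂ → ℝ) (s : Set ℂ) : Prop :=
  ∀ z ∈ s, ∃ F : ℂ → ℂ, (∀ᶠ w in 𝓝 z, DifferentiableAt ℂ F w) ∧ (F z).re = G z ∧
    ∀ᶠ w in 𝓝 z, (F w).re ≤ G w

/-- Maximum modulus principle for `exp F`, whose modulus is `exp (Re F)`. -/
theorem eventually_re_eq_of_isLocalMax {F : ℂ → ℂ} {z : ℂ}
    (hF : ∀ᶠ w in 𝓝 z, DifferentiableAt ℂ F w) (hz : IsLocalMax (fun w => (F w).re) z) :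
    ∀ᶠ w in 𝓝 z, (F w).re = (F z).re := by
  have h := Complex.eventually_eq_of_isLocalMax_norm (f := fun w => Complex.exp (F w)) (c := z)
    (hF.mono fun w hw => hw.cexp) (by
      filter_upwards [hz] with w hw
      simpa [Complex.norm_exp] using hw)
  filter_upwards [h] with w hw
  have := congrArg norm hw
  simpa [Complex.norm_exp] using this

theorem exists_norm_lt_of_eventually_nhds {p : ℂ → Prop} {z : ℂ} (h : ∀ᶠ w in 𝓝 z, p w) :
    ∃ w, p w ∧ ‖z‖ < ‖w‖ := by
  obtain ⟨ε, hε, hb⟩ := Metric.eventually_nhds_iff.1 h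
  rcases eq_or_ne z 0 with rfl | hz
  · refine ⟨((ε / 2 : ℝ) : ℂ), hb ?_, ?_⟩
    · rw [dist_zero_right, Complex.norm_real, Real.norm_eq_abs, abs_of_pos (by positivity)]
      linarith
    · rw [Complex.norm_real, Real.norm_eq_abs, abs_of_pos (by positivity), norm_zero]
      positivity
  · have hz0 : 0 < ‖z‖ := norm_pos_iff.2 hz
    have hc : 0 < ε / (2 * ‖z‖) := by positivity
    refine ⟨((1 + ε / (2 * ‖z‖) : ℝ) : ℂ) * z, hb ?_, ?_⟩
    · have : ((1 + ε / (2 * ‖z‖) : ℝ) : ℂ) * z - z = ((ε / (2 * ‖z‖) : ℝ) : ℂ) * z := by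
        push_cast; ring
      rw [dist_eq_norm, this, norm_mul, Complex.norm_real, Real.norm_eq_abs, abs_of_pos hc]
      field_simp
      linarith
    · rw [norm_mul, Complex.norm_real, Real.norm_eq_abs, abs_of_pos (by positivity)]
      nlinarith

/-- Were the maximum of `G - Re p` positive, it would be attained only in the open ball. At a
maximum point `x` of largest modulus, `Re (F - p)` for the minorant `F` has a local maximum and is
locally constant. Thus `G - Re p` stays maximal throughout a neighbourhood of `x`, which contains
points of larger modulus. -/
theorem HasHolomorphicMinorants.le_re_of_le_on_sphere {G : ℂ → ℝ} {r : ℝ}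
    (hG : HasHolomorphicMinorants G (Metric.ball 0 r))
    (hGc : ContinuousOn G (Metric.closedBall 0 r)) {p : ℂ → ℂ} (hp : Differentiable ℂ p)
    (hle : ∀ z ∈ Metric.sphere (0 : ℂ) r, G z ≤ (p z).re) {z : ℂ}
    (hz : z ∈ Metric.closedBall 0 r) : G z ≤ (p z).re := by
  set D : ℂ → ℝ := fun w => G w - (p w).re with hD
  have hDc : ContinuousOn D (Metric.closedBall 0 r) :=
    hGc.sub (Complex.continuous_re.comp hp.continuous).continuousOn
  have hK := isCompact_closedBall (0 : ℂ) r
  obtain ⟨y, hy, hmax⟩ := hK.exists_isMaxOn ⟨z, hz⟩ hDc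
  by_contra! hlt
  have hypos : 0 < D y := lt_of_lt_of_le (by simp only [hD]; linarith) (hmax hz)
  have hS : IsCompact (Metric.closedBall (0 : ℂ) r ∩ D ⁻¹' {D y}) :=
    hK.of_isClosed_subset (hDc.preimage_isClosed_of_isClosed Metric.isClosed_closedBall
      isClosed_singleton) Set.inter_subset_left
  obtain ⟨x, ⟨hx, hxD⟩, hxmax⟩ := hS.exists_isMaxOn ⟨y, hy, rfl⟩ continuous_norm.continuousOn
  have hxD' : D x = D y := hxD
  have hxr : x ∈ Metric.ball (0 : ℂ) r := by
    refine lt_of_le_of_ne (Metric.mem_closedBall.1 hx) fun h => ?_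
    have := hle x h
    simp only [hD] at hxD' hypos
    linarith
  obtain ⟨F, hF, hFx, hFle⟩ := hG x hxr
  have hnhds : ∀ᶠ w in 𝓝 x, w ∈ Metric.closedBall (0 : ℂ) r := by
    filter_upwards [Metric.isOpen_ball.mem_nhds hxr] with w hw using Metric.ball_subset_closedBall hw
  have hloc : IsLocalMax (fun w => (F w - p w).re) x := by
    filter_upwards [hFle, hnhds] with w hw hwr
    have h1 : D w ≤ D y := hmax hwr
    simp only [hD, Complex.sub_re] at h1 hxD' ⊢
    linarith
  have heq := eventually_re_eq_of_isLocalMax (hF.mono fun w hw => hw.sub (hp w)) hloc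
  obtain ⟨w, ⟨hw1, hw2, hw3⟩, hwx⟩ :=
    exists_norm_lt_of_eventually_nhds (heq.and (hFle.and hnhds))
  have h1 : D w ≤ D y := hmax hw3
  have h2 : D w = D y := by
    refine le_antisymm h1 ?_
    simp only [hD, Pi.sub_apply, Complex.sub_re] at hw1 hxD' ⊢
    linarith
  exact absurd (hxmax ⟨hw3, h2⟩) (not_le.2 hwx)

/-! ### Comparison with the Poisson integral of the boundary values -/

theorem exists_differentiable_eq_add_conj_of_mem_span_fourier {T : C(Torus, ℂ)}
    (hT : T ∈ Submodule.span ℂ (Set.range (fourier (T := 2 * Real.pi)))) :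
    ∃ p q : ℂ → ℂ, Differentiable ℂ p ∧ Differentiable ℂ q ∧
      ∀ θ, T θ = p (boundaryPoint θ) + conj (q (boundaryPoint θ)) := by
  induction hT using Submodule.span_induction with
  | mem T h =>
    obtain ⟨n, rfl⟩ := h
    obtain ⟨m, rfl | rfl⟩ := n.eq_nat_or_neg
    · exact ⟨fun w => w ^ m, 0, by fun_prop, differentiable_zero, fun θ => by
        simp [fourier_natCast_eq_boundaryPoint_pow, -fourier_apply]⟩
    · exact ⟨0, fun w => w ^ m, differentiable_zero, by fun_prop, fun θ => by
        rw [fourier_neg, fourier_natCast_eq_boundaryPoint_pow]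
        simp⟩
  | zero => exact ⟨0, 0, differentiable_zero, differentiable_zero, by simp⟩
  | add S T _ _ hS hT =>
    obtain ⟨p, q, hp, hq, h⟩ := hS
    obtain ⟨p', q', hp', hq', h'⟩ := hT
    exact ⟨p + p', q + q', hp.add hp', hq.add hq', fun θ => by
      simp [h, h']; ring⟩
  | smul c T _ hT =>
    obtain ⟨p, q, hp, hq, h⟩ := hT
    exact ⟨c • p, conj c • q, hp.const_smul c, hq.const_smul _, fun θ => by
      simp [h]; ring⟩

/-- Real continuous functions on the circle are uniform limits of real parts of entire functions. -/
theorem exists_differentiable_abs_re_sub_lt {g : Torus → ℝ} (hg : Continuous g) {ε : ℝ}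
    (hε : 0 < ε) :
    ∃ p : ℂ → ℂ, Differentiable ℂ p ∧ ∀ θ, |(p (boundaryPoint θ)).re - g θ| < ε := by
  set g' : C(Torus, ℂ) := ⟨fun θ => (g θ : ℂ), by fun_prop⟩ with hg'
  have hmem : g' ∈ (Submodule.span ℂ
      (Set.range (fourier (T := 2 * Real.pi)))).topologicalClosure := by
    rw [span_fourier_closure_eq_top]
    exact Submodule.mem_top
  obtain ⟨T, hT, hTd⟩ := Metric.mem_closure_iff.1 hmem ε hε
  obtain ⟨p, q, hp, hq, h⟩ := exists_differentiable_eq_add_conj_of_mem_span_fourier hT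
  refine ⟨p + q, hp.add hq, fun θ => ?_⟩
  have h1 : ‖T θ - g' θ‖ < ε := by
    rw [← dist_eq_norm, dist_comm]
    exact (ContinuousMap.dist_apply_le_dist θ).trans_lt hTd
  have h2 := (Complex.abs_re_le_norm (T θ - g' θ)).trans_lt h1
  simpa [h, hg'] using h2

theorem poissonIntegral_mono {g₁ g₂ : Torus → ℝ} (h₁ : Integrable g₁) (h₂ : Integrable g₂)
    (h : ∀ θ, g₁ θ ≤ g₂ θ) {z : ℂ} (hz : ‖z‖ < 1) :
    poissonIntegral g₁ z ≤ poissonIntegral g₂ z := by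
  simp only [poissonIntegral]
  refine mul_le_mul_of_nonneg_left (integral_mono (integrable_poissonKernel_mul h₁ hz)
    (integrable_poissonKernel_mul h₂ hz) fun θ => ?_) (by positivity)
  exact mul_le_mul_of_nonneg_left (h θ) (poissonKernel_boundaryPoint_nonneg hz θ)

theorem poissonIntegral_add_const {g : Torus → ℝ} (hg : Integrable g) (c : ℝ) {z : ℂ}
    (hz : ‖z‖ < 1) : poissonIntegral (fun θ => g θ + c) z = poissonIntegral g z + c := by
  conv_rhs => rw [← poissonIntegral_const c hz]
  simp only [poissonIntegral]
  rw [← mul_add, ← integral_add (integrable_poissonKernel_mul hg hz)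
    (integrable_poissonKernel_mul (integrable_const c) hz)]
  simp only [mul_add]

theorem HasHolomorphicMinorants.le_poissonIntegral {G : ℂ → ℝ}
    (hG : HasHolomorphicMinorants G (Metric.ball 0 1))
    (hGc : ContinuousOn G (Metric.closedBall 0 1)) {z : ℂ} (hz : ‖z‖ < 1) :
    G z ≤ poissonIntegral (fun θ => G (boundaryPoint θ)) z := by
  have hint : ∀ φ : Torus → ℝ, Continuous φ → Integrable φ := fun φ hφ =>
    hφ.integrable_of_hasCompactSupport (HasCompactSupport.of_compactSpace _)
  have hgc : Continuous fun θ : Torus => G (boundaryPoint θ) :=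
    hGc.comp_continuous continuous_boundaryPoint fun θ => by simp [norm_boundaryPoint]
  refine le_of_forall_pos_le_add fun ε hε => ?_
  -- Approximating `G + ε/2` to within `ε/2` places `Re p` between `G` and `G + ε` on the circle.
  obtain ⟨p, hp, hpg⟩ := exists_differentiable_abs_re_sub_lt
    (g := fun θ => G (boundaryPoint θ) + ε / 2) (hgc.add continuous_const) (half_pos hε)
  have hsphere : ∀ w ∈ Metric.sphere (0 : ℂ) 1, G w ≤ (p w).re := by
    intro w hw
    have hw1 : ‖w‖ = 1 := by simpa using hw
    have hwθ : boundaryPoint (w.arg : Torus) = w := by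
      rw [boundaryPoint_coe]
      simpa [hw1] using Complex.norm_mul_exp_arg_mul_I w
    have := (abs_lt.1 (hpg (w.arg : Torus))).1
    simp only [hwθ] at this
    linarith
  calc G z ≤ (p z).re := hG.le_re_of_le_on_sphere hGc hp hsphere (by simpa using hz.le)
    _ = poissonIntegral (fun θ => (p (boundaryPoint θ)).re) z :=
        (poissonIntegral_of_differentiable hp hz).symm
    _ ≤ poissonIntegral (fun θ => G (boundaryPoint θ) + ε) z := by
        refine poissonIntegral_mono (hint _ (Complex.continuous_re.comp
          (hp.continuous.comp continuous_boundaryPoint))) (hint _ (hgc.add continuous_const))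
          (fun θ => ?_) hz
        have := (abs_lt.1 (hpg θ)).2
        simp only [Function.comp_apply, Pi.add_apply]
        linarith
    _ = _ := poissonIntegral_add_const (hint _ hgc) ε hz

/-- A bounded continuous function with holomorphic minorants on the disc is dominated by the Poisson
integral of its radial boundary values. -/
theorem HasHolomorphicMinorants.le_poissonIntegral_of_tendsto {G : ℂ → ℝ}
    (hG : HasHolomorphicMinorants G (Metric.ball 0 1))
    (hGc : ContinuousOn G (Metric.ball 0 1)) {C : ℝ} (hC : ∀ z, ‖z‖ < 1 → |G z| ≤ C)
    {L : Torus → ℝ} (hL : ∀ᵐ θ : Torus,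
      Tendsto (fun r : ℝ => G (r * boundaryPoint θ)) (𝓝[<] 1) (𝓝 (L θ)))
    {z : ℂ} (hz : ‖z‖ < 1) : G z ≤ poissonIntegral L z := by
  have hlt : ∀ {r : ℝ}, r ∈ Set.Ioo (0 : ℝ) 1 → ∀ w : ℂ, ‖w‖ ≤ 1 → ‖(r : ℂ) * w‖ < 1 := by
    intro r hr w hw
    rw [norm_mul, Complex.norm_real, Real.norm_eq_abs, abs_of_pos hr.1]
    nlinarith [hr.1, hr.2]
  have hcont : ∀ {r : ℝ}, r ∈ Set.Ioo (0 : ℝ) 1 →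
      ContinuousOn (fun w : ℂ => G (r * w)) (Metric.closedBall 0 1) := by
    intro r hr
    refine hGc.comp (by fun_prop) fun w hw => ?_
    simpa using hlt hr w (by simpa using hw)
  have hev : ∀ᶠ r : ℝ in 𝓝[<] 1, r ∈ Set.Ioo (0 : ℝ) 1 := Ioo_mem_nhdsLT zero_lt_one
  -- The dilate `G(r ·)` is continuous up to the circle; `r → 1` is then handled by dominated
  -- convergence.
  have hineq : ∀ᶠ r : ℝ in 𝓝[<] 1,
      G (r * z) ≤ poissonIntegral (fun θ => G (r * boundaryPoint θ)) z := by
    filter_upwards [hev] with r hr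
    refine HasHolomorphicMinorants.le_poissonIntegral (G := fun w : ℂ => G (r * w)) ?_ (hcont hr) hz
    intro w hw
    obtain ⟨F, hF, hFw, hFle⟩ := hG (r * w) (by
      simpa using hlt hr w (mem_ball_zero_iff.1 hw).le)
    have ht : Tendsto (fun w : ℂ => (r : ℂ) * w) (𝓝 w) (𝓝 (r * w)) :=
      (by fun_prop : Continuous fun w : ℂ => (r : ℂ) * w).tendsto w
    exact ⟨fun w => F (r * w), (ht.eventually hF).mono fun v hv =>
      DifferentiableAt.comp v hv (by fun_prop), hFw, ht.eventually hFle⟩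
  have hleft : Tendsto (fun r : ℝ => G (r * z)) (𝓝[<] 1) (𝓝 (G z)) := by
    have h1 : ContinuousAt G z := hGc.continuousAt (Metric.isOpen_ball.mem_nhds (by simpa using hz))
    have h2 : Tendsto (fun r : ℝ => (r : ℂ) * z) (𝓝[<] 1) (𝓝 z) := by
      have : Continuous fun r : ℝ => (r : ℂ) * z := by fun_prop
      simpa using (this.tendsto 1).mono_left nhdsWithin_le_nhds
    exact h1.tendsto.comp h2
  have hkc := continuous_poissonKernel_boundaryPoint hz
  have hright : Tendsto (fun r : ℝ => poissonIntegral (fun θ => G (r * boundaryPoint θ)) z)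
      (𝓝[<] 1) (𝓝 (poissonIntegral L z)) := by
    refine Tendsto.const_mul _ (tendsto_integral_filter_of_dominated_convergence
      (fun θ => poissonKernel 0 z (boundaryPoint θ) * C) ?_ ?_ ?_ ?_)
    · filter_upwards [hev] with r hr
      exact (hkc.mul ((hcont hr).comp_continuous continuous_boundaryPoint fun θ => by
        simp [norm_boundaryPoint])).aestronglyMeasurable
    · filter_upwards [hev] with r hr
      refine ae_of_all _ fun θ => ?_
      rw [norm_mul, Real.norm_of_nonneg (poissonKernel_boundaryPoint_nonneg hz θ)]
      exact mul_le_mul_of_nonneg_left (hC _ (hlt hr _ (norm_boundaryPoint θ).le))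
        (poissonKernel_boundaryPoint_nonneg hz θ)
    · exact integrable_poissonKernel_mul (integrable_const C) hz
    · filter_upwards [hL] with θ hθ using hθ.const_mul _
  exact le_of_tendsto_of_tendsto hleft hright hineq

/-! ### A bounded subharmonic barrier for the strip `|Re w| < π / 2` -/

/-- The positive harmonic function `e^y cos x` of the strip `|x| < π / 2`, extended by zero. -/
noncomputable def stripHarmonic (x y : ℝ) : ℝ :=
  Real.exp y * Real.cos (max (-(Real.pi / 2)) (min (Real.pi / 2) x))

/-- A subharmonic function that vanishes for `π / 2 ≤ |Re w| ≤ M` and `Im w ≤ l - M`, is bounded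
above on every strip `|Re w| ≤ M`, and is at least `exp (Im w - l)` on the imaginary axis below
height `l + 1`. -/
noncomputable def stripBarrier (l : ℝ) (w : ℂ) : ℝ :=
  if w.im - l ≤ 1 then
    max (stripHarmonic w.re (w.im - l)) (5 * (w.im - l) - (w.im - l) ^ 2 + w.re ^ 2)
  else max 0 (5 * (w.im - l) - (w.im - l) ^ 2 + w.re ^ 2)

theorem stripHarmonic_nonneg (x y : ℝ) : 0 ≤ stripHarmonic x y := by
  refine mul_nonneg (Real.exp_pos _).le (Real.cos_nonneg_of_neg_pi_div_two_le_of_le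
    (le_max_left _ _) (max_le ?_ (min_le_left _ _)))
  linarith [Real.pi_pos]

theorem stripHarmonic_le_exp (x y : ℝ) : stripHarmonic x y ≤ Real.exp y :=
  mul_le_of_le_one_right (Real.exp_pos _).le (Real.cos_le_one _)

theorem stripHarmonic_of_abs_le {x : ℝ} (hx : |x| ≤ Real.pi / 2) (y : ℝ) :
    stripHarmonic x y = Real.exp y * Real.cos x := by
  rw [stripHarmonic, min_eq_right (abs_le.1 hx).2, max_eq_right (abs_le.1 hx).1]

theorem stripHarmonic_of_le_abs {x : ℝ} (hx : Real.pi / 2 ≤ |x|) (y : ℝ) :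
    stripHarmonic x y = 0 := by
  have hpi := Real.pi_pos
  rcases le_abs.1 hx with h | h
  · rw [stripHarmonic, min_eq_left h, max_eq_right (by linarith), Real.cos_pi_div_two, mul_zero]
  · rw [stripHarmonic, min_eq_right (by linarith), max_eq_left (by linarith), Real.cos_neg,
      Real.cos_pi_div_two, mul_zero]

theorem continuous_stripBarrier (l : ℝ) : Continuous (stripBarrier l) := by
  unfold stripBarrier stripHarmonic
  refine Continuous.if_le (by fun_prop) (by fun_prop) (by fun_prop) (by fun_prop) ?_
  intro w hw
  rw [hw]
  -- At the seam `Im w - l = 1` the quadratic equals `4 + x²`, which exceeds `e` and hence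
  -- `stripHarmonic`, so it wins in both branches.
  have h1 := stripHarmonic_le_exp w.re 1
  have h2 := Real.exp_one_lt_d9
  have h3 := sq_nonneg w.re
  unfold stripHarmonic at h1
  rw [max_eq_right (by linarith), max_eq_right (by linarith)]

theorem stripBarrier_nonneg (l : ℝ) (w : ℂ) : 0 ≤ stripBarrier l w := by
  unfold stripBarrier
  split_ifs
  · exact le_max_of_le_left (stripHarmonic_nonneg _ _)
  · exact le_max_left _ _

theorem le_stripBarrier (l : ℝ) (w : ℂ) :
    5 * (w.im - l) - (w.im - l) ^ 2 + w.re ^ 2 ≤ stripBarrier l w := by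
  unfold stripBarrier
  split_ifs <;> exact le_max_right _ _

theorem stripHarmonic_le_stripBarrier {l : ℝ} {w : ℂ} (hw : w.im - l ≤ 1) :
    stripHarmonic w.re (w.im - l) ≤ stripBarrier l w := by
  rw [stripBarrier, if_pos hw]
  exact le_max_left _ _

theorem stripBarrier_le (l : ℝ) {w : ℂ} {M : ℝ} (hw : |w.re| ≤ M) :
    stripBarrier l w ≤ 7 + M ^ 2 := by
  have h1 : 5 * (w.im - l) - (w.im - l) ^ 2 + w.re ^ 2 ≤ 7 + M ^ 2 := by
    have : w.re ^ 2 ≤ M ^ 2 := sq_le_sq' (abs_le.1 hw).1 (abs_le.1 hw).2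
    nlinarith [sq_nonneg (w.im - l - 5 / 2)]
  unfold stripBarrier
  split_ifs with h
  · refine max_le ((stripHarmonic_le_exp _ _).trans ?_) h1
    have h2 := Real.exp_le_exp.2 h
    have h3 := Real.exp_one_lt_d9
    nlinarith [sq_nonneg M]
  · exact max_le (by positivity) h1

theorem stripBarrier_eq_zero {l M : ℝ} {w : ℂ} (h1 : Real.pi / 2 ≤ |w.re|) (h2 : |w.re| ≤ M)
    (h3 : w.im ≤ l - M) : stripBarrier l w = 0 := by
  have hM : 0 ≤ M := (abs_nonneg _).trans h2
  have h4 : 5 * (w.im - l) - (w.im - l) ^ 2 + w.re ^ 2 ≤ 0 := by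
    have : w.re ^ 2 ≤ M ^ 2 := sq_le_sq' (abs_le.1 h2).1 (abs_le.1 h2).2
    nlinarith
  rw [stripBarrier, if_pos (by linarith), stripHarmonic_of_le_abs h1, max_eq_left h4]

/-- At each point the active piece is a minorant: `0`, the quadratic (the real part of a polynomial,
below the barrier everywhere), or `e^y cos x`. The last is active with a positive value only for
`|x| < π/2` and strictly below the seam, hence in an open region where it is harmonic and below the
barrier. -/
theorem hasHolomorphicMinorants_stripBarrier (l : ℝ) :
    HasHolomorphicMinorants (stripBarrier l) Set.univ := by
  intro w _
  by_cases h0 : stripBarrier l w = 0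
  · exact ⟨fun _ => 0, by simp, by simp [h0], by simp [stripBarrier_nonneg]⟩
  by_cases hQ : stripBarrier l w = 5 * (w.im - l) - (w.im - l) ^ 2 + w.re ^ 2
  · have hre : ∀ v : ℂ, ((v - l * Complex.I) ^ 2 - 5 * Complex.I * (v - l * Complex.I)).re
        = 5 * (v.im - l) - (v.im - l) ^ 2 + v.re ^ 2 := by
      intro v
      simp [pow_two]
      ring
    exact ⟨fun v => (v - l * Complex.I) ^ 2 - 5 * Complex.I * (v - l * Complex.I),
      Eventually.of_forall fun v => by fun_prop, by rw [hre, hQ],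
      Eventually.of_forall fun v => by rw [hre]; exact le_stripBarrier l v⟩
  have hle : w.im - l ≤ 1 := by
    by_contra h
    rw [stripBarrier, if_neg h] at h0 hQ
    rcases max_choice 0 (5 * (w.im - l) - (w.im - l) ^ 2 + w.re ^ 2) with h' | h'
    · exact h0 h'
    · exact hQ h'
  have hV : stripBarrier l w = stripHarmonic w.re (w.im - l) := by
    rw [stripBarrier, if_pos hle] at hQ ⊢
    exact (max_choice _ _).resolve_right hQ
  have hlt : w.im - l < 1 := by
    refine lt_of_le_of_ne hle fun h => ?_
    have h1 := le_stripBarrier l w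
    have h2 := stripHarmonic_le_exp w.re (w.im - l)
    rw [← hV] at h2
    rw [h] at h1 h2
    nlinarith [Real.exp_one_lt_d9, sq_nonneg w.re]
  have hx : |w.re| < Real.pi / 2 := by
    by_contra! h
    exact h0 (hV.trans (stripHarmonic_of_le_abs h _))
  have hre : ∀ v : ℂ, (Complex.exp (-(Complex.I * v) - l)).re
      = Real.exp (v.im - l) * Real.cos v.re := by
    intro v
    simp [Complex.exp_re]
  refine ⟨fun v => Complex.exp (-(Complex.I * v) - l),
    Eventually.of_forall fun v => by fun_prop, ?_, ?_⟩
  · rw [hre, hV, stripHarmonic_of_abs_le hx.le]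
  · have h1 : ∀ᶠ v : ℂ in 𝓝 w, |v.re| < Real.pi / 2 :=
      (by fun_prop : Continuous fun v : ℂ => |v.re|).continuousAt.eventually (gt_mem_nhds hx)
    have h2 : ∀ᶠ v : ℂ in 𝓝 w, v.im - l < 1 :=
      (by fun_prop : Continuous fun v : ℂ => v.im - l).continuousAt.eventually (gt_mem_nhds hlt)
    filter_upwards [h1, h2] with v hv1 hv2
    rw [hre, ← stripHarmonic_of_abs_le hv1.le]
    exact stripHarmonic_le_stripBarrier hv2.le

theorem HasHolomorphicMinorants.comp {G : ℂ → ℝ} (hG : HasHolomorphicMinorants G Set.univ)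
    {X : ℂ → ℂ} {s : Set ℂ} (hs : IsOpen s) (hX : DifferentiableOn ℂ X s) :
    HasHolomorphicMinorants (fun z => G (X z)) s := by
  intro z hz
  obtain ⟨F, hF, hFz, hFle⟩ := hG (X z) (Set.mem_univ _)
  have hc : Tendsto X (𝓝 z) (𝓝 (X z)) := (hX.differentiableAt (hs.mem_nhds hz)).continuousAt
  refine ⟨fun w => F (X w), ?_, hFz, hc.eventually hFle⟩
  filter_upwards [hc.eventually hF, hs.mem_nhds hz] with w hw hws
  exact DifferentiableAt.comp w hw (hX.differentiableAt (hs.mem_nhds hws))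

/-! ### Distribution of the conjugate function -/

theorem tendsto_ofReal_mul_boundaryPoint {α : ℝ} (hα : 1 < α) (t : Torus) :
    Tendsto (fun r : ℝ => (r : ℂ) * boundaryPoint t) (𝓝[<] 1)
      (𝓝[approachRegion α (boundaryPoint t)] boundaryPoint t) := by
  refine tendsto_nhdsWithin_iff.mpr ⟨?_, ?_⟩
  · have hc : Continuous fun r : ℝ => (r : ℂ) * boundaryPoint t := by fun_prop
    simpa using (hc.tendsto 1).mono_left nhdsWithin_le_nhds
  · filter_upwards [Ioo_mem_nhdsLT (zero_lt_one' ℝ)] with r hr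
    have h1 : ‖(r : ℂ) * boundaryPoint t‖ = r := by
      rw [norm_mul, norm_boundaryPoint, mul_one, Complex.norm_real, Real.norm_eq_abs,
        abs_of_pos hr.1]
    have h2 : ‖(r : ℂ) * boundaryPoint t - boundaryPoint t‖ = 1 - r := by
      have : (r : ℂ) * boundaryPoint t - boundaryPoint t
          = ((r - 1 : ℝ) : ℂ) * boundaryPoint t := by push_cast; ring
      rw [this, norm_mul, norm_boundaryPoint, mul_one, Complex.norm_real, Real.norm_eq_abs,
        abs_of_neg (by linarith [hr.2])]
      ring
    refine ⟨by rw [h1]; exact hr.2, ?_⟩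
    rw [h1, h2]
    nlinarith [hr.2]

theorem HasNontangentialLimit.tendsto_radial {φ : ℂ → ℝ} {t : Torus} {a : ℝ}
    (h : HasNontangentialLimit φ (boundaryPoint t) a) :
    Tendsto (fun r : ℝ => φ (r * boundaryPoint t)) (𝓝[<] 1) (𝓝 a) :=
  (h 2 one_lt_two).comp (tendsto_ofReal_mul_boundaryPoint one_lt_two t)

theorem abs_poissonIntegral_le {h : Torus → ℝ} {M : ℝ}
    (hM : ∀ᵐ t : Torus, |h t| ≤ M) {z : ℂ} (hz : ‖z‖ < 1) : |poissonIntegral h z| ≤ M := by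
  have h1 := norm_integral_le_of_norm_le (integrable_poissonKernel_mul (integrable_const M) hz)
    (f := fun θ : Torus => poissonKernel 0 z (boundaryPoint θ) * h θ) (by
      filter_upwards [hM] with θ hθ
      rw [norm_mul, Real.norm_of_nonneg (poissonKernel_boundaryPoint_nonneg hz θ)]
      exact mul_le_mul_of_nonneg_left hθ (poissonKernel_boundaryPoint_nonneg hz θ))
  rw [poissonIntegral, abs_mul, abs_of_pos (by positivity : 0 < (2 * Real.pi)⁻¹)]
  refine (mul_le_mul_of_nonneg_left h1 (by positivity)).trans (le_of_eq ?_)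
  exact poissonIntegral_const M hz

theorem continuousOn_poissonIntegral {h : Torus → ℝ} (hh : Integrable h) :
    ContinuousOn (poissonIntegral h) (Metric.ball 0 1) := by
  refine (Complex.continuous_re.comp_continuousOn
    (differentiableOn_herglotzIntegral hh).continuousOn).congr fun z hz => ?_
  rw [Function.comp_apply, herglotzIntegral_eq hh (by simpa using hz)]
  simp

theorem poissonIntegral_le_measureReal {L : Torus → ℝ} {C : ℝ} {S : Set Torus}
    (hS : NullMeasurableSet S) (hL0 : ∀ t, 0 ≤ L t)
    (hL : ∀ᵐ t : Torus, L t ≤ S.indicator (fun _ => C) t) {z : ℂ} (hz : ‖z‖ < 1) :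
    poissonIntegral L z ≤ (2 * Real.pi)⁻¹ * (2 / (1 - ‖z‖)) * C * volume.real S := by
  have hδ : 0 < 1 - ‖z‖ := by linarith
  have hi : Integrable (S.indicator fun _ : Torus => C) :=
    (integrable_const C).indicator₀ hS
  have h1 : ∫ θ : Torus, poissonKernel 0 z (boundaryPoint θ) * L θ ≤
      ∫ θ : Torus, 2 / (1 - ‖z‖) * S.indicator (fun _ => C) θ := by
    refine integral_mono_of_nonneg (ae_of_all _ fun θ =>
      mul_nonneg (poissonKernel_boundaryPoint_nonneg hz θ) (hL0 θ)) (hi.const_mul _) ?_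
    filter_upwards [hL] with θ hθ
    exact mul_le_mul (poissonKernel_le_two_div hz θ) hθ (hL0 θ) (by positivity)
  rw [integral_const_mul, integral_indicator₀ hS, setIntegral_const, smul_eq_mul] at h1
  rw [poissonIntegral]
  refine (mul_le_mul_of_nonneg_left h1 (by positivity)).trans (le_of_eq ?_)
  ring

/-- If `h` is bounded with `|h| ≥ π / 2` and its Poisson integral vanishes at some point of the
disc, then the boundary function `g` of the harmonic conjugate has an exponential lower tail
bound. -/
theorem exists_pos_le_measureReal_of_poissonIntegral_eq_zero {h g : Torus → ℝ} {M : ℝ}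
    (hh : Integrable h) (hg : Integrable g)
    (hconj : ∀ z : ℂ, ‖z‖ < 1 → conjugatePoissonIntegral h z = poissonIntegral g z)
    (hM : ∀ᵐ t : Torus, |h t| ≤ M) (hpi : ∀ᵐ t : Torus, Real.pi / 2 ≤ |h t|)
    {z₀ : ℂ} (hz₀ : ‖z₀‖ < 1) (h0 : poissonIntegral h z₀ = 0) :
    ∃ C : ℝ, 0 < C ∧ ∀ l : ℝ, 0 ≤ l →
      C * Real.exp (-l) ≤ volume.real {t : Torus | l < g t} := by
  set X := herglotzIntegral h with hX
  have hXeq : ∀ z : ℂ, ‖z‖ < 1 → X z = poissonIntegral h z + poissonIntegral g z * Complex.I := by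
    intro z hz
    rw [hX, herglotzIntegral_eq hh hz, hconj z hz]
  have hM0 : 0 ≤ M := (abs_nonneg _).trans (abs_poissonIntegral_le hM hz₀)
  set y₀ := poissonIntegral g z₀ with hy₀
  have hδ : 0 < 1 - ‖z₀‖ := by linarith
  set A : ℝ := (2 * Real.pi)⁻¹ * (2 / (1 - ‖z₀‖)) * (7 + M ^ 2) with hA
  have hApos : 0 < A := by positivity
  refine ⟨Real.exp (-(M + 2 * |y₀|)) / A, by positivity, fun l hl => ?_⟩
  -- Since `m - M ≥ l`, the barrier at height `m` vanishes at the boundary values with `g t ≤ l`.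
  -- Since `m ≥ y₀`, its exponential branch is available at `X z₀`.
  set m : ℝ := l + M + |y₀| with hm
  have hlim : ∀ᵐ t : Torus, Tendsto (fun r : ℝ => stripBarrier m (X (r * boundaryPoint t)))
      (𝓝[<] 1) (𝓝 (stripBarrier m (h t + g t * Complex.I))) := by
    filter_upwards [ae_hasNontangentialLimit_poissonIntegral hh,
      ae_hasNontangentialLimit_poissonIntegral hg] with t ht1 ht2
    have h1 : Tendsto (fun r : ℝ => ((poissonIntegral h (r * boundaryPoint t) : ℝ) : ℂ) +
        (poissonIntegral g (r * boundaryPoint t) : ℝ) * Complex.I) (𝓝[<] 1)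
        (𝓝 (h t + g t * Complex.I)) :=
      ((Complex.continuous_ofReal.tendsto _).comp ht1.tendsto_radial).add
        (((Complex.continuous_ofReal.tendsto _).comp ht2.tendsto_radial).mul_const _)
    refine ((continuous_stripBarrier m).tendsto _).comp (h1.congr' ?_)
    filter_upwards [Ioo_mem_nhdsLT (zero_lt_one' ℝ)] with r hr
    rw [hXeq]
    rw [norm_mul, norm_boundaryPoint, mul_one, Complex.norm_real, Real.norm_eq_abs,
      abs_of_pos hr.1]
    exact hr.2
  have hXd : DifferentiableOn ℂ X (Metric.ball 0 1) := differentiableOn_herglotzIntegral hh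
  have h1 := ((hasHolomorphicMinorants_stripBarrier m).comp Metric.isOpen_ball
    hXd).le_poissonIntegral_of_tendsto
      ((continuous_stripBarrier m).comp_continuousOn hXd.continuousOn) (C := 7 + M ^ 2)
      (fun z hz => by
        rw [abs_of_nonneg (stripBarrier_nonneg _ _)]
        refine stripBarrier_le m ?_
        rw [hXeq z hz]
        simpa using abs_poissonIntegral_le hM hz) hlim hz₀
  have hS : NullMeasurableSet {t : Torus | l < g t} :=
    nullMeasurableSet_lt aemeasurable_const hg.aestronglyMeasurable.aemeasurable
  have h2 := poissonIntegral_le_measureReal (C := 7 + M ^ 2)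
    (L := fun t => stripBarrier m (h t + g t * Complex.I)) hS
    (fun t => stripBarrier_nonneg _ _) (by
      filter_upwards [hM, hpi] with t ht1 ht2
      by_cases hgt : l < g t
      · rw [Set.indicator_of_mem (show t ∈ {t | l < g t} from hgt)]
        exact stripBarrier_le m (by simpa using ht1)
      · rw [Set.indicator_of_notMem (show t ∉ {t | l < g t} from hgt)]
        refine (stripBarrier_eq_zero (M := M) ?_ ?_ ?_).le
        · simpa using ht2
        · simpa using ht1
        · simp only [Complex.add_im, Complex.ofReal_im, Complex.mul_im, Complex.ofReal_re,
            Complex.I_im, Complex.I_re]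
          linarith [abs_nonneg y₀, not_lt.1 hgt]) hz₀
  have h3 : Real.exp (y₀ - m) ≤ stripBarrier m (X z₀) := by
    have hre : (X z₀).re = 0 := by rw [hXeq z₀ hz₀]; simp [h0]
    have him : (X z₀).im = y₀ := by rw [hXeq z₀ hz₀]; simp [hy₀]
    have h4 := stripHarmonic_le_stripBarrier (l := m) (w := X z₀) (by
      rw [him]; linarith [le_abs_self y₀])
    rw [hre, him, stripHarmonic_of_abs_le (by rw [abs_zero]; positivity), Real.cos_zero,
      mul_one] at h4
    exact h4
  have h5 : Real.exp (-(M + 2 * |y₀|)) * Real.exp (-l) ≤ Real.exp (y₀ - m) := by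
    rw [← Real.exp_add]
    refine Real.exp_le_exp.2 ?_
    linarith [neg_abs_le y₀]
  rw [div_mul_eq_mul_div, div_le_iff₀ hApos, mul_comm _ A]
  exact h5.trans (h3.trans (h1.trans h2))

/-- The exponential of a function whose upper tail decays no faster than `exp (-l)` is not
integrable. -/
theorem not_integrable_exp_of_le_measureReal {Ω : Type*} [MeasurableSpace Ω] {μ : Measure Ω}
    [IsFiniteMeasure μ] {φ : Ω → ℝ} {C : ℝ} (hC : 0 < C)
    (h : ∀ l : ℝ, 0 ≤ l → C * Real.exp (-l) ≤ μ.real {t | l < φ t}) :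
    ¬ Integrable (fun t => Real.exp (φ t)) μ := by
  intro hi
  have hφ : AEMeasurable φ μ := by
    simpa [Function.comp_def] using Real.measurable_log.comp_aemeasurable
      hi.aestronglyMeasurable.aemeasurable
  have hS : ∀ n : ℕ, NullMeasurableSet {t | (n : ℝ) < φ t} μ := fun n =>
    nullMeasurableSet_lt aemeasurable_const hφ
  -- Chebyshev's inequality over the whole space gives no contradiction with the tail bound.
  -- Restricted to `{φ > n}` it does: those integrals tend to 0, yet each is at least `C`.
  have hlim : Tendsto (fun n : ℕ => ∫ t, {t | (n : ℝ) < φ t}.indicator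
      (fun t => Real.exp (φ t)) t ∂μ) atTop (𝓝 (∫ _, (0 : ℝ) ∂μ)) := by
    refine tendsto_integral_of_dominated_convergence (fun t => Real.exp (φ t))
      (fun n => hi.aestronglyMeasurable.indicator₀ (hS n)) hi (fun n => ae_of_all _ fun t => ?_)
      (ae_of_all _ fun t => ?_)
    · rw [← Real.norm_of_nonneg (Real.exp_pos (φ t)).le]
      exact norm_indicator_le_norm_self (fun t => Real.exp (φ t)) t
    · refine tendsto_const_nhds.congr' ?_
      filter_upwards [eventually_ge_atTop ⌈φ t⌉₊] with n hn
      have : t ∉ {t | (n : ℝ) < φ t} := not_lt.2 (Nat.ceil_le.1 hn)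
      rw [Set.indicator_of_notMem this]
  rw [integral_zero] at hlim
  obtain ⟨n, hn⟩ := (hlim.eventually (gt_mem_nhds hC)).exists
  have h1 : Real.exp n * μ.real {t | (n : ℝ) < φ t} ≤
      ∫ t, {t | (n : ℝ) < φ t}.indicator (fun t => Real.exp (φ t)) t ∂μ := by
    have h2 : ∫ t, {t | (n : ℝ) < φ t}.indicator (fun _ => Real.exp n) t ∂μ =
        Real.exp n * μ.real {t | (n : ℝ) < φ t} := by
      rw [integral_indicator₀ (hS n), setIntegral_const, smul_eq_mul, mul_comm]
    rw [← h2]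
    refine integral_mono ((integrable_const _).indicator₀ (hS n)) (hi.indicator₀ (hS n))
      fun t => ?_
    by_cases ht : t ∈ {t | (n : ℝ) < φ t}
    · simp only [Set.indicator_of_mem ht]
      exact Real.exp_le_exp.2 (le_of_lt ht)
    · simp only [Set.indicator_of_notMem ht, le_refl]
  have h3 : C ≤ Real.exp n * μ.real {t | (n : ℝ) < φ t} := by
    have h4 := mul_le_mul_of_nonneg_left (h n (Nat.cast_nonneg n)) (Real.exp_pos (n : ℝ)).le
    have h5 : Real.exp (n : ℝ) * (C * Real.exp (-(n : ℝ))) = C := by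
      rw [mul_left_comm, ← Real.exp_add, add_neg_cancel, Real.exp_zero, mul_one]
    linarith
  linarith

/-! ### The sign change of `f ρ_E` and the conclusion -/

theorem abs_rho (E : Set Torus) (t : Torus) : |rho E t| = 1 := by
  by_cases h : t ∈ E
  · simp [rho, h]
    norm_num
  · simp [rho, h]

/-- Near the two boundary points the Poisson integral has opposite signs along radii; the disc is
connected. -/
theorem exists_poissonIntegral_eq_zero {h : Torus → ℝ} (hh : Integrable h) {s t : Torus}
    (hs : HasNontangentialLimit (poissonIntegral h) (boundaryPoint s) (h s)) (hs0 : 0 < h s)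
    (ht : HasNontangentialLimit (poissonIntegral h) (boundaryPoint t) (h t)) (ht0 : h t < 0) :
    ∃ z : ℂ, ‖z‖ < 1 ∧ poissonIntegral h z = 0 := by
  have hball : ∀ θ : Torus, ∀ᶠ r : ℝ in 𝓝[<] 1, (r : ℂ) * boundaryPoint θ ∈
      Metric.ball (0 : ℂ) 1 := by
    intro θ
    filter_upwards [Ioo_mem_nhdsLT (zero_lt_one' ℝ)] with r hr
    rw [mem_ball_zero_iff, norm_mul, norm_boundaryPoint, mul_one, Complex.norm_real,
      Real.norm_eq_abs, abs_of_pos hr.1]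
    exact hr.2
  obtain ⟨r, hr, hr'⟩ := ((hs.tendsto_radial.eventually (lt_mem_nhds hs0)).and (hball s)).exists
  obtain ⟨q, hq, hq'⟩ := ((ht.tendsto_radial.eventually (gt_mem_nhds ht0)).and (hball t)).exists
  obtain ⟨z, hz, hz0⟩ := (convex_ball (0 : ℂ) 1).isPreconnected.intermediate_value hq' hr'
    (continuousOn_poissonIntegral hh) ⟨hq.le, hr.le⟩
  exact ⟨z, by simpa using hz, hz0⟩

theorem theorem1p0 (f : Torus → ℝ) (hf : MemLp f ⊤ volume)
    (hf_ge : ∀ᵐ t : Torus, Real.pi / 2 ≤ f t)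
    (E : Set Torus) (hE : NullMeasurableSet E volume)
    (hE_pos : 0 < volume E) (hE_lt : volume E < ENNReal.ofReal (2 * Real.pi)) :
    -- the conjugate function of `f ρ_E` exists almost everywhere and is measurable
    (∀ᵐ t : Torus, HasNontangentialLimit (conjugatePoissonIntegral fun s => f s * rho E s)
        (boundaryPoint t) (conjugateFunction (fun s => f s * rho E s) t)) ∧
    AEMeasurable (conjugateFunction fun s => f s * rho E s) volume ∧
    (∃ C : ℝ, 0 < C ∧ ∀ l : ℝ, 0 ≤ l →
      ENNReal.ofReal (C * Real.exp (-l)) ≤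
        volume {t : Torus | l < conjugateFunction (fun s => f s * rho E s) t}) ∧
    ¬ MemLp (fun t : Torus => Real.exp (conjugateFunction (fun s => f s * rho E s) t)) 1 volume := by
  set h : Torus → ℝ := fun s => f s * rho E s with hh_def
  have habs : ∀ t, |h t| = |f t| := fun t => by rw [hh_def, abs_mul, abs_rho, mul_one]
  have hrho : AEStronglyMeasurable (rho E) volume :=
    ((aestronglyMeasurable_const.indicator₀ hE).const_mul 2).sub aestronglyMeasurable_const
  have hh_top : MemLp h ⊤ volume :=
    hf.mono (hf.aestronglyMeasurable.mul hrho) (ae_of_all _ fun t => (habs t).le)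
  have hh2 : MemLp h 2 volume := hh_top.mono_exponent le_top
  have hhi : Integrable h := hh2.integrable (by norm_num)
  have hM : ∀ᵐ t : Torus, |h t| ≤ (eLpNormEssSup h volume).toReal := by
    have hfin : eLpNormEssSup h volume < ⊤ := by simpa using hh_top.2
    filter_upwards [ae_le_eLpNormEssSup (f := h) (μ := volume)] with t ht
    have := ENNReal.toReal_mono hfin.ne ht
    simpa using this
  have hpi : ∀ᵐ t : Torus, Real.pi / 2 ≤ |h t| := by
    filter_upwards [hf_ge] with t ht
    rw [habs]
    exact ht.trans (le_abs_self _)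
  obtain ⟨g, hg2, hconj⟩ := exists_conjugatePoissonIntegral_eq_poissonIntegral hh2
  have hgi : Integrable g := hg2.integrable (by norm_num)
  have hnt : ∀ᵐ t : Torus,
      HasNontangentialLimit (conjugatePoissonIntegral h) (boundaryPoint t) (g t) := by
    filter_upwards [ae_hasNontangentialLimit_poissonIntegral hgi] with t ht α hα
    refine (ht α hα).congr' ?_
    filter_upwards [self_mem_nhdsWithin] with z hz using (hconj z hz.1).symm
  have hcf : ∀ᵐ t : Torus, conjugateFunction h t = g t :=
    hnt.mono fun t ht => ht.conjugateFunction_eq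
  have hFatou := ae_hasNontangentialLimit_poissonIntegral hhi
  have hEc : volume Eᶜ ≠ 0 := by
    intro h0
    have h1 : volume (Set.univ : Set Torus) ≤ volume E + volume Eᶜ := by
      rw [← Set.union_compl_self E]
      exact measure_union_le _ _
    rw [h0, add_zero, AddCircle.measure_univ] at h1
    exact absurd hE_lt (not_lt.2 h1)
  -- Both `E` and its complement have positive measure, so each contains a point where Fatou's
  -- theorem and `f ≥ π/2` hold.
  obtain ⟨s, hsE, hs1, hs2⟩ :=
    ((frequently_ae_mem_iff.2 hE_pos.ne').and_eventually (hFatou.and hf_ge)).exists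
  obtain ⟨t, htE, ht1, ht2⟩ :=
    ((frequently_ae_mem_iff.2 hEc).and_eventually (hFatou.and hf_ge)).exists
  have hpi0 := Real.pi_pos
  have hs0 : 0 < h s := by
    simp only [hh_def, rho, Set.indicator_of_mem hsE]
    linarith
  have ht0 : h t < 0 := by
    simp only [hh_def, rho, Set.indicator_of_notMem htE]
    linarith
  obtain ⟨z₀, hz₀, h0⟩ := exists_poissonIntegral_eq_zero hhi hs1 hs0 ht1 ht0
  obtain ⟨C, hC, hbound⟩ :=
    exists_pos_le_measureReal_of_poissonIntegral_eq_zero hhi hgi hconj hM hpi hz₀ h0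
  refine ⟨?_, ?_, ⟨C, hC, fun l hl => ?_⟩, fun hmem => ?_⟩
  · filter_upwards [hnt, hcf] with t ht1 ht2
    rwa [ht2]
  · exact hgi.aestronglyMeasurable.aemeasurable.congr (hcf.mono fun t ht => ht.symm)
  · have hset : volume {t : Torus | l < conjugateFunction h t} = volume {t : Torus | l < g t} := by
      refine measure_congr ?_
      filter_upwards [hcf] with t ht
      change (l < conjugateFunction h t) = (l < g t)
      rw [ht]
    rw [hset]
    exact (ENNReal.ofReal_le_ofReal (hbound l hl)).trans ENNReal.ofReal_toReal_le
  · refine not_integrable_exp_of_le_measureReal hC hbound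
      ((memLp_one_iff_integrable.1 hmem).congr ?_)
    filter_upwards [hcf] with t ht
    rw [ht]
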